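/- Let $\mathfrak g$ be a finite-dimensional simple complex Lie algebra, $\mathfrak h$ a Cartan subalgebra, $\theta$ the maximal root with respect to some base of the root system, $\langle\ ,\ \rangle$ the symmetric invariant bilinear form on $\mathfrak g$ with $\langle\theta,\theta\rangle=2$ (where $\mathfrak h\cong\mathfrak h^*$ via the form), and $x_\theta\neq 0$ a root vector for $\theta$. Let $\hat{\mathfrak g}=\coprod_{j\in\mathbb Z}\mathfrak g\otimes t^j+\mathbb C c$ and $\tilde{\mathfrak g}=\hat{\mathfrak g}+\mathbb C d$ be the affine Lie algebras with $c$ central, $x(i)=x\otimes t^i$, $$[x(i),y(j)]=[x,y](i+j)+i\,\delta_{i+j,0}\langle x,y\rangle c,\qquad [d,x(i)]=i\,x(i).$$ Fix an integer $k\geq 1$. Let $N(k\Lambda_0)=U(\tilde{\mathfrak g})\otimes_{U(\tilde{\mathfrak g}_{\ge 0}+\mathbb C c)}\mathbb C v_k$, where $\tilde{\mathfrak g}_{\ge 0}=\coprod_{j\ge 0}\mathfrak g\otimes t^j+\mathbb C d$ acts on $v_k$ by $0$ and $c$ by $k$; let $N^1(k\Lambda_0)$ be its maximal (proper) submodule,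 $L(k\Lambda_0)=N(k\Lambda_0)/N^1(k\Lambda_0)$ the standard module and $\mathbf 1\in L(k\Lambda_0)$ the image of $1\otimes v_k$. Let $B$ be a basis of $\mathfrak g$. A colored partition is a finite multiset (commutative monomial) $\Pi$ of parts $b(j)$, $b\in B$, $j\in\mathbb Z$; $\ell(\Pi)$ is its number of parts, $|\Pi|$ the sum of the degrees $j$ of its parts, $\Pi\Phi$ is the product of monomials, and $\mathcal P$ is the set of all colored partitions, $\mathcal P_{<0}$ the set of those all of whose parts have negative degree. Let $\preceq$ be a linear order on $\mathcal P$ such that * $\ell(\Pi)>\ell(\Phi)$ implies $\Pi\prec\Phi$; if $\ell(\Pi)=\ell(\Phi)$, then $|\Pi|<|\Phi|$ implies $\Pi\prec\Phi$; * if $\ell(\Pi)=\ell(\Phi)$, $|\Pi|=|\Phi|$ and $\Pi\preceq\Phi$, then the largest degree of a part of $\Pi$ is at most the largest degree of a part of $\Phi$; * every nonempty set of colored partitions of a fixed degree and of bounded length has a minimal element; * $\Phi\preceq\Psi$ implies $\Pi\Phi\preceq\Pi\Psi$; * every nonempty subset of $\mathcal P_{<0}$ has a largest element (that is, $\succ$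 is a well order on $\mathcal P_{<0}$). For $\Pi\in\mathcal P$ with parts $X_1(j_1)\preceq X_2(j_2)\preceq\dots\preceq X_\ell(j_\ell)$ let $X(\Pi)=X_1(j_1)X_2(j_2)\cdots X_\ell(j_\ell)$, a monomial in an enveloping algebra. Let $\mathcal U=U(\hat{\mathfrak g})/(c-k)$; infinite sums are taken in the completion of $\mathcal U$ for which the left ideals generated by $\{x(j)\mid x\in\mathfrak g,\ j\geq N\}$, $N\geq 0$, are a basis of neighbourhoods of $0$. For $m\in\mathbb Z$ let $$r_{(k+1)\theta}(m)=\sum_{j_1+\dots+j_{k+1}=m}x_\theta(j_1)\cdots x_\theta(j_{k+1}),$$ the coefficients of the annihilating field $x_\theta(z)^{k+1}$. The relations are the elements $r(m)=u\cdot r_{(k+1)\theta}(m)$ with $u\in U(\mathfrak g)$ and $m\in\mathbb Z$, where $u$ acts by the (termwise) adjoint action. Writing a nonzero relation as $r(m)=\sum_{\Psi\in\mathcal P}c_\Psi X(\Psi)$, its leading term is the smallest $\Psi$ with $c_\Psi\neq 0$. Let $\mathcal R$ be the set of leading terms of all nonzero relations and let $\mathcal D$ be the set of all colored partitions that contain no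 element of $\mathcal R$ (i.e. are not of the form $\Psi\Phi$ with $\Psi\in\mathcal P$, $\Phi\in\mathcal R$); they are said to satisfy the difference conditions. **Proposition.** The standard module $L(k\Lambda_0)$ is spanned (over $\mathbb C$) by the set of vectors $$X(\Pi)\,\mathbf 1,\qquad \Pi\in\mathcal D\cap\mathcal P_{<0}.$$ -/

import Mathlib

namespace AffineStd
noncomputable section

open LieAlgebra TensorProduct

variable {g : Type*} [LieRing g] [LieAlgebra ℂ g]

variable (g) in
/-- Symmetric invariant bilinear forms on `g`. -/
structure InvForm where
  form : LinearMap.BilinForm ℂ g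
  symm : form.IsSymm
  inv : form.lieInvariant g

/-- The 2-cocycle `(x ⊗ tⁱ, y ⊗ tʲ) ↦ i δ_{i+j,0} ⟨x, y⟩` on the loop algebra. (Mathlib's cocycle
`Res f dg` takes the value `j δ_{i+j,0} ⟨x, y⟩`, hence the sign.) -/
def cocycle (Φ : InvForm g) :
    LieModule.Cohomology.twoCocycle ℂ (loopAlgebra ℂ ℤ g)
      (TrivialLieModule ℂ (loopAlgebra ℂ ℤ g) ℂ) :=
  LoopAlgebra.twoCocycleOfBilinear ℂ ℤ g (-Φ.form)
    (fun x y z => by simp [Φ.inv x y z]) ⟨fun x y => by simp [Φ.symm.eq x y]⟩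

/-- The affine Lie algebra `ĝ = ∐ g ⊗ tʲ + ℂ c`. -/
abbrev Hat (Φ : InvForm g) : Type _ := ofTwoCocycle (cocycle Φ)

/-- The element `x(i) = x ⊗ tⁱ` of the loop algebra. -/
def loopElt (x : g) (i : ℤ) : loopAlgebra ℂ ℤ g := AddMonoidAlgebra.single i 1 ⊗ₜ[ℂ] x

/-- The inclusion of the vector space `g ⊗ ℂ[t, t⁻¹]` in `ĝ`. -/
def ofLoop (Φ : InvForm g) : loopAlgebra ℂ ℤ g →ₗ[ℂ] Hat Φ where
  toFun l := ofProd _ (l, 0)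
  map_add' a b := by rw [← of_add]; simp
  map_smul' a b := by rw [RingHom.id_apply, ← of_smul]; simp

/-- The element `x(i)` of `ĝ`. -/
def hatElt (Φ : InvForm g) (x : g) (i : ℤ) : Hat Φ := ofLoop Φ (loopElt x i)

/-- The canonical central element `c` of `ĝ`. -/
def hatC (Φ : InvForm g) : Hat Φ :=
  ofProd _ (0, (TrivialLieModule.equiv ℂ (loopAlgebra ℂ ℤ g) ℂ).symm 1)

theorem cocycle_loopElt (Φ : InvForm g) (x y : g) (i j : ℤ) :
    LoopAlgebra.residuePairing ℂ ℤ g (-Φ.form) (loopElt x i) (loopElt y j) =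
      if i + j = 0 then (i : ℂ) * Φ.form x y else 0 := by
  rw [LoopAlgebra.residuePairing_apply_apply, loopElt, loopElt,
    LoopAlgebra.toFinsupp_single_tmul, LoopAlgebra.toFinsupp_single_tmul,
    Finsupp.sum_single_index (by simp)]
  by_cases h : i + j = 0
  · obtain rfl : j = -i := by lia
    simp
  · have hij : i ≠ -j := by lia
    rw [Finsupp.single_eq_of_ne hij.symm]
    simp [h]

theorem hat_lie (Φ : InvForm g) (a b : loopAlgebra ℂ ℤ g)
    (z w : TrivialLieModule ℂ (loopAlgebra ℂ ℤ g) ℂ) :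
    ⁅ofProd (cocycle Φ) (a, z), ofProd (cocycle Φ) (b, w)⁆ =
      ofLoop Φ ⁅a, b⁆ + LoopAlgebra.residuePairing ℂ ℤ g (-Φ.form) a b • hatC Φ := by
  rw [bracket_ofTwoCocycle, hatC, ofLoop, ← of_smul]
  simp only [LinearMap.coe_mk, AddHom.coe_mk, Equiv.symm_apply_apply]
  rw [← of_add]
  refine congrArg _ (Prod.ext (by simp) ?_)
  simp only [trivial_lie_zero, add_zero, sub_zero, Prod.mk_add_mk, Prod.smul_mk, zero_add]
  rw [← map_smul, smul_eq_mul, mul_one]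
  rfl

theorem loopElt_lie (x y : g) (i j : ℤ) :
    ⁅loopElt x i, loopElt y j⁆ = loopElt ⁅x, y⁆ (i + j) := by
  rw [loopElt, loopElt, ExtendScalars.bracket_tmul, AddMonoidAlgebra.single_mul_single, one_mul,
    loopElt]

theorem hatElt_lie (Φ : InvForm g) (x y : g) (i j : ℤ) :
    ⁅hatElt Φ x i, hatElt Φ y j⁆ =
      hatElt Φ ⁅x, y⁆ (i + j) + (if i + j = 0 then (i : ℂ) * Φ.form x y else 0) • hatC Φ := by
  rw [← cocycle_loopElt, hatElt, hatElt, hatElt, ← loopElt_lie]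
  exact hat_lie Φ _ _ _ _

theorem hatC_lie (Φ : InvForm g) (a : Hat Φ) : ⁅hatC Φ, a⁆ = 0 := by
  have h := hat_lie Φ 0 ((ofProd _).symm a).1
    ((TrivialLieModule.equiv ℂ (loopAlgebra ℂ ℤ g) ℂ).symm 1) ((ofProd _).symm a).2
  rw [zero_lie ((ofProd (cocycle Φ)).symm a).1, map_zero, map_zero, LinearMap.zero_apply,
    zero_smul, add_zero] at h
  exact h

/-- The derivation `x ⊗ tⁱ ↦ i x ⊗ tⁱ` of the loop algebra, as a linear map. -/
def loopD : loopAlgebra ℂ ℤ g →ₗ[ℂ] loopAlgebra ℂ ℤ g :=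
  (LoopAlgebra.toFinsupp ℂ ℤ g).symm.toLinearMap ∘ₗ
    Finsupp.lsum ℂ (fun i : ℤ => (i : ℂ) • Finsupp.lsingle i) ∘ₗ
    (LoopAlgebra.toFinsupp ℂ ℤ g).toLinearMap

theorem loopD_loopElt (x : g) (i : ℤ) : loopD (loopElt x i) = (i : ℂ) • loopElt x i := by
  simp only [loopD, loopElt, LinearMap.coe_comp, LinearEquiv.coe_coe, Function.comp_apply,
    LoopAlgebra.toFinsupp_single_tmul]
  rw [Finsupp.lsum_apply, Finsupp.sum_single_index (by simp), LinearMap.smul_apply, map_smul,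
    Finsupp.lsingle_apply, LoopAlgebra.toFinsupp_symm_single]

theorem loop_induction {p : loopAlgebra ℂ ℤ g → Prop} (zero : p 0)
    (add : ∀ a b, p a → p b → p (a + b)) (elt : ∀ x i, p (loopElt x i)) (a) : p a := by
  rw [← (LoopAlgebra.toFinsupp ℂ ℤ g).symm_apply_apply a]
  induction LoopAlgebra.toFinsupp ℂ ℤ g a using Finsupp.induction_linear with
  | zero => simpa using zero
  | add u v hu hv => rw [map_add]; exact add _ _ hu hv
  | single i x => rw [LoopAlgebra.toFinsupp_symm_single]; exact elt x i

theorem loopD_lie (a b : loopAlgebra ℂ ℤ g) :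
    loopD ⁅a, b⁆ = ⁅a, loopD b⁆ - ⁅b, loopD a⁆ := by
  induction a using loop_induction with
  | zero => rw [zero_lie b, map_zero, zero_lie (loopD b), lie_zero b, sub_zero]
  | add a a' h h' =>
    rw [add_lie a a' b, map_add, h, h', map_add, lie_add b, add_lie a a' (loopD b)]; abel
  | elt x i =>
    induction b using loop_induction with
    | zero => rw [map_zero, lie_zero (loopElt x i), zero_lie (loopD _), map_zero, sub_zero]
    | add b b' h h' =>
      rw [lie_add (loopElt x i) b b', map_add, h, h', map_add, add_lie b b' (loopD _),
        lie_add (loopElt x i)]; abel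
    | elt y j =>
      rw [loopD_loopElt, loopD_loopElt, lie_smul (j : ℂ) (loopElt x i) (loopElt y j),
        lie_smul (i : ℂ) (loopElt y j) (loopElt x i), ← lie_skew (loopElt y j) (loopElt x i), loopElt_lie,
        loopD_loopElt, smul_neg, sub_neg_eq_add, ← add_smul]
      push_cast
      rw [add_comm (j : ℂ)]

theorem residue_loopD (Φ : InvForm g) (a b : loopAlgebra ℂ ℤ g) :
    LoopAlgebra.residuePairing ℂ ℤ g (-Φ.form) a (loopD b) =
      LoopAlgebra.residuePairing ℂ ℤ g (-Φ.form) b (loopD a) := by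
  induction a using loop_induction with
  | zero => simp
  | add a a' h h' => rw [map_add, LinearMap.add_apply, h, h', map_add, map_add]
  | elt x i =>
    induction b using loop_induction with
    | zero => simp
    | add b b' h h' => rw [map_add, map_add, h, h', map_add, LinearMap.add_apply]
    | elt y j =>
      rw [loopD_loopElt, loopD_loopElt, map_smul, map_smul, cocycle_loopElt, cocycle_loopElt,
        add_comm j i, Φ.symm.eq x y]
      split_ifs
      · simp only [smul_eq_mul]; ring
      · simp

/-- The derivation of `ĝ` with `x(i) ↦ i x(i)` and `c ↦ 0`. -/
def hatD (Φ : InvForm g) : LieDerivation ℂ (Hat Φ) (Hat Φ) where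
  toFun a := ofLoop Φ (loopD ((ofProd _).symm a).1)
  map_add' a b := by simp
  map_smul' a b := by simp
  leibniz' a b := by
    have h1 := hat_lie Φ ((ofProd _).symm a).1 (loopD ((ofProd _).symm b).1)
      ((ofProd _).symm a).2 0
    have h2 := hat_lie Φ ((ofProd _).symm b).1 (loopD ((ofProd _).symm a).1)
      ((ofProd _).symm b).2 0
    refine Eq.trans ?_ (congrArg₂ (· - ·) h1 h2).symm
    simp only [residue_loopD Φ ((ofProd _).symm a).1, add_sub_add_right_eq_sub]
    rw [← map_sub, ← loopD_lie]
    rfl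

section
attribute [local instance 100] LieRing.ofAssociativeRing

/-- The action of the one-dimensional Lie algebra `ℂ d` on `ĝ` by multiples of the derivation. -/
def dAction (Φ : InvForm g) : ℂ →ₗ⁅ℂ⁆ LieDerivation ℂ (Hat Φ) (Hat Φ) where
  toFun a := a • hatD Φ
  map_add' a b := add_smul a b _
  map_smul' a b := by simp [mul_smul]
  map_lie' {a b} := by
    rw [smul_lie, lie_smul, lie_self, smul_zero, smul_zero, LieRing.of_associative_ring_bracket,
      mul_comm, sub_self, zero_smul]

/-- The affine Kac-Moody Lie algebra `g̃ = ĝ + ℂ d`. -/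
abbrev Tilde (Φ : InvForm g) : Type _ := SemiDirectSum (Hat Φ) ℂ (dAction Φ)

/-- The inclusion `ĝ → g̃`. -/
def hatToTilde (Φ : InvForm g) : Hat Φ →ₗ⁅ℂ⁆ Tilde Φ := SemiDirectSum.inl (dAction Φ)

/-- The element `d` of `g̃`. -/
def tildeD (Φ : InvForm g) : Tilde Φ := SemiDirectSum.inr (dAction Φ) 1

theorem tildeD_lie (Φ : InvForm g) (x : g) (i : ℤ) :
    ⁅tildeD Φ, hatToTilde Φ (hatElt Φ x i)⁆ = (i : ℂ) • hatToTilde Φ (hatElt Φ x i) := by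
  rw [← map_smul, hatElt, ← map_smul, ← loopD_loopElt]
  refine SemiDirectSum.ext ?_ ?_
  · change ⁅(0 : Hat Φ), ofLoop Φ (loopElt x i)⁆ + ((1 : ℂ) • hatD Φ) (ofLoop Φ (loopElt x i)) -
      ((0 : ℂ) • hatD Φ) 0 = _
    rw [zero_lie, one_smul, map_zero, zero_add, sub_zero]
    rfl
  · simp [tildeD, hatToTilde]

end

/-! ### Enveloping algebras and modules -/

section Enveloping

attribute [local instance 100] LieRing.ofAssociativeRing

/-- The relation `c = k` in `U(ĝ)`. -/
inductive LevelRel (Φ : InvForm g) (k : ℕ) :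
    UniversalEnvelopingAlgebra ℂ (Hat Φ) → UniversalEnvelopingAlgebra ℂ (Hat Φ) → Prop
  | level : LevelRel Φ k (UniversalEnvelopingAlgebra.ι ℂ (hatC Φ)) (algebraMap ℂ _ (k : ℂ))

/-- The associative algebra `𝒰 = U(ĝ)/(c - k)`. -/
abbrev EnvLevel (Φ : InvForm g) (k : ℕ) : Type _ := RingQuot (LevelRel Φ k)

/-- The canonical map `ĝ → 𝒰`. -/
def toEnv (Φ : InvForm g) (k : ℕ) : Hat Φ →ₗ⁅ℂ⁆ EnvLevel Φ k :=
  (RingQuot.mkAlgHom ℂ (LevelRel Φ k) : _ →ₗ⁅ℂ⁆ EnvLevel Φ k).comp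
    (UniversalEnvelopingAlgebra.ι ℂ)

/-- The element `x(i)` of `𝒰`. -/
def envElt (Φ : InvForm g) (k : ℕ) (x : g) (i : ℤ) : EnvLevel Φ k := toEnv Φ k (hatElt Φ x i)

/-- The inclusion `g = g ⊗ 1 → ĝ`. -/
def fromFinite (Φ : InvForm g) : g →ₗ⁅ℂ⁆ Hat Φ where
  toFun x := hatElt Φ x 0
  map_add' x y := by
    rw [hatElt, loopElt, TensorProduct.tmul_add, map_add, hatElt, hatElt, loopElt, loopElt]
  map_smul' a x := by
    rw [hatElt, loopElt, TensorProduct.tmul_smul, map_smul, hatElt, loopElt, RingHom.id_apply]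
  map_lie' {x y} := by
    rw [hatElt_lie]
    simp

/-- The adjoint action of `U(g)` on `𝒰`; an element `x` of `g` acts by `a ↦ x(0) a - a x(0)`. -/
def adAction (Φ : InvForm g) (k : ℕ) :
    UniversalEnvelopingAlgebra ℂ g →ₐ[ℂ] Module.End ℂ (EnvLevel Φ k) :=
  UniversalEnvelopingAlgebra.lift ℂ
    ((LieAlgebra.ad ℂ (EnvLevel Φ k)).comp ((toEnv Φ k).comp (fromFinite Φ)))

theorem adAction_ι (Φ : InvForm g) (k : ℕ) (x : g) (a : EnvLevel Φ k) :
    adAction Φ k (UniversalEnvelopingAlgebra.ι ℂ x) a =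
      envElt Φ k x 0 * a - a * envElt Φ k x 0 := by
  rw [adAction, UniversalEnvelopingAlgebra.lift_ι_apply]
  rfl

/-- The left ideal of `𝒰` generated by all `x(j)`, `x ∈ g`, `j ≥ N`. These left ideals form the
basis of neighbourhoods of zero with respect to which infinite sums in (the completion of) `𝒰`
are understood. -/
def tailIdeal (Φ : InvForm g) (k : ℕ) (N : ℕ) : Ideal (EnvLevel Φ k) :=
  Ideal.span {a | ∃ (x : g) (j : ℤ), (N : ℤ) ≤ j ∧ a = envElt Φ k x j}

/-- The canonical map `g̃ → U(g̃)` on the element `x(i)`. -/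
def uTildeElt (Φ : InvForm g) (x : g) (i : ℤ) : UniversalEnvelopingAlgebra ℂ (Tilde Φ) :=
  UniversalEnvelopingAlgebra.ι ℂ (hatToTilde Φ (hatElt Φ x i))

/-- The left ideal of `U(g̃)` generated by `x(j)`, `x ∈ g`, `j ≥ 0`, by `d` and by `c - k`, i.e.
by the kernel of the character of `U(g̃_{≥0} + ℂ c)` that defines `ℂ v_k`. -/
def vacuumIdeal (Φ : InvForm g) (k : ℕ) : Ideal (UniversalEnvelopingAlgebra ℂ (Tilde Φ)) :=
  Ideal.span ({a | ∃ (x : g) (j : ℤ), 0 ≤ j ∧ a = uTildeElt Φ x j} ∪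
    {UniversalEnvelopingAlgebra.ι ℂ (tildeD Φ),
      UniversalEnvelopingAlgebra.ι ℂ (hatToTilde Φ (hatC Φ)) - algebraMap ℂ _ (k : ℂ)})

/-- The generalized Verma module `N(kΛ₀) = U(g̃) ⊗_{U(g̃_{≥0} + ℂ c)} ℂ v_k`, written as the
quotient of `U(g̃)` by the left ideal annihilating `1 ⊗ v_k`. -/
abbrev GenVerma (Φ : InvForm g) (k : ℕ) : Type _ :=
  UniversalEnvelopingAlgebra ℂ (Tilde Φ) ⧸ vacuumIdeal Φ k

/-- The maximal submodule `N¹(kΛ₀)`: the sum of all proper submodules. -/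
def maxSubmodule (Φ : InvForm g) (k : ℕ) :
    Submodule (UniversalEnvelopingAlgebra ℂ (Tilde Φ)) (GenVerma Φ k) :=
  sSup {p | p ≠ ⊤}

/-- The standard module `L(kΛ₀) = N(kΛ₀)/N¹(kΛ₀)`. -/
abbrev StdModule (Φ : InvForm g) (k : ℕ) : Type _ := GenVerma Φ k ⧸ maxSubmodule Φ k

/-- The vacuum (highest weight) vector of `L(kΛ₀)`. -/
def vacuum (Φ : InvForm g) (k : ℕ) : StdModule Φ k :=
  Submodule.Quotient.mk (Submodule.Quotient.mk 1)

end Enveloping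

/-! ### Colored partitions -/

section Partitions

variable {ι : Type*}

/-- Colored partitions with colors in `ι`: monomials in the parts `b(j)`, written `(b, j)`, with
`b ∈ ι` and `j ∈ ℤ`. The product of monomials is the sum of multisets, and `Ψ ⊂ Π` is `Ψ ≤ Π`. -/
abbrev ColPart (ι : Type*) : Type _ := Multiset (ι × ℤ)

/-- The degree `|Π|`. -/
def ColPart.degree (P : ColPart ι) : ℤ := (P.map Prod.snd).sum

/-- Colored partitions with parts of negative degree. -/
def negParts (ι : Type*) : Set (ColPart ι) := {P | ∀ p ∈ P, p.2 < 0}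

/-- The linear orders `≼` on the set of colored partitions that are used to define leading
terms. -/
structure PartOrder (ι : Type*) where
  /-- The relation `Π ≼ Φ`. -/
  le : ColPart ι → ColPart ι → Prop
  refl : ∀ P, le P P
  trans : ∀ P Q T, le P Q → le Q T → le P T
  antisymm : ∀ P Q, le P Q → le Q P → P = Q
  total : ∀ P Q, le P Q ∨ le Q P
  /-- Longer partitions are smaller. -/
  le_of_length : ∀ P Q, Q.card < P.card → le P Q
  /-- For equal lengths, partitions of smaller degree are smaller. -/
  le_of_degree : ∀ P Q, P.card = Q.card → P.degree < Q.degree → le P Q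
  /-- For equal lengths and degrees, `Π ≼ Φ` implies that the largest degree of a part of `Π` is
  at most the largest degree of a part of `Φ`. -/
  maxPart_le : ∀ P Q, P.card = Q.card → P.degree = Q.degree → le P Q →
    ∀ p ∈ P, ∃ q ∈ Q, p.2 ≤ q.2
  /-- Partitions of fixed degree and bounded length: nonempty sets have minimal elements. -/
  exists_min : ∀ (ℓ : ℕ) (m : ℤ) (S : Set (ColPart ι)), S.Nonempty →
    (∀ P ∈ S, P.card ≤ ℓ ∧ P.degree = m) → ∃ P ∈ S, ∀ Q ∈ S, le P Q
  mul_le_mul : ∀ P Q T, le Q T → le (P + Q) (P + T)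
  /-- The partitions with negative parts are well ordered from the largest one downwards. -/
  exists_max : ∀ S : Set (ColPart ι), S.Nonempty → S ⊆ negParts ι → ∃ P ∈ S, ∀ Q ∈ S, le Q P

/-- The order on the parts, i.e. on partitions of length one. -/
def PartOrder.partLE (o : PartOrder ι) (p q : ι × ℤ) : Prop := o.le {p} {q}

instance (o : PartOrder ι) : IsTrans (ι × ℤ) o.partLE := ⟨fun _ _ _ => o.trans _ _ _⟩

instance (o : PartOrder ι) : Std.Antisymm o.partLE :=
  ⟨fun _ _ h h' => Multiset.singleton_inj.1 (o.antisymm _ _ h h')⟩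

instance (o : PartOrder ι) : Std.Total o.partLE := ⟨fun _ _ => o.total _ _⟩

open Classical in
/-- The ordered monomial `X₁(j₁) X₂(j₂) ⋯ X_ℓ(j_ℓ)`, `X₁(j₁) ≼ X₂(j₂) ≼ ⋯`, of the partition `P`,
for a given value `X(p)` of every part `p`. -/
def PartOrder.monomial (o : PartOrder ι) {A : Type*} [Monoid A] (X : ι × ℤ → A)
    (P : ColPart ι) : A :=
  ((P.sort o.partLE).map X).prod

/-- The monomial `X(Π) ∈ 𝒰`. -/
def envMonomial (Φ : InvForm g) (k : ℕ) (B : Module.Basis ι ℂ g) (o : PartOrder ι)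
    (P : ColPart ι) : EnvLevel Φ k :=
  o.monomial (fun p => envElt Φ k (B p.1) p.2) P

/-- The monomial vector `X(Π) 1 ∈ L(kΛ₀)`. -/
def monomialVector (Φ : InvForm g) (k : ℕ) (B : Module.Basis ι ℂ g) (o : PartOrder ι)
    (P : ColPart ι) : StdModule Φ k :=
  o.monomial (fun p => uTildeElt Φ (B p.1) p.2) P • vacuum Φ k

end Partitions

/-! ### Relations and their leading terms -/

/-- The (finitely many) tuples `(j₁, …, j_n)` of integers less than `N` with sum `m`. -/
def sumTuples (n : ℕ) (m : ℤ) (N : ℕ) : Finset (Fin n → ℤ) :=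
  (Fintype.piFinset fun _ => Finset.Ico (m - n * N) N).filter fun j => ∑ i, j i = m

theorem mem_sumTuples {n : ℕ} {m : ℤ} {N : ℕ} {j : Fin n → ℤ} :
    j ∈ sumTuples n m N ↔ (∀ i, j i < N) ∧ ∑ i, j i = m := by
  simp only [sumTuples, Finset.mem_filter, Fintype.mem_piFinset, Finset.mem_Ico]
  refine ⟨fun h => ⟨fun i => (h.1 i).2, h.2⟩, fun h => ⟨fun i => ⟨?_, h.1 i⟩, h.2⟩⟩
  have h1 : ∑ l ∈ Finset.univ.erase i, j l ≤ ∑ l ∈ Finset.univ.erase i, (N : ℤ) :=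
    Finset.sum_le_sum fun l _ => (h.1 l).le
  have h2 := Finset.add_sum_erase Finset.univ j (Finset.mem_univ i)
  rw [Finset.sum_const, Finset.card_erase_of_mem (Finset.mem_univ i), Finset.card_univ,
    Fintype.card_fin, nsmul_eq_mul] at h1
  have h3 : ((n - 1 : ℕ) : ℤ) * N ≤ n * N := by gcongr; lia
  linarith [h.2]

/-- The sum of those terms of the infinite sum
`u · r_{(k+1)θ}(m) = ∑_{j₁ + ⋯ + j_{k+1} = m} u · (x_θ(j₁) ⋯ x_θ(j_{k+1}))`, `u ∈ U(g)`, in which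
all `j_i` are less than `N`. The other terms lie in `tailIdeal Φ k N`: the factors `x_θ(j)` commute
with each other, and the ideal is stable under the adjoint action of `U(g)`. -/
def relTrunc (Φ : InvForm g) (k : ℕ) (xθ : g) (u : UniversalEnvelopingAlgebra ℂ g) (m : ℤ)
    (N : ℕ) : EnvLevel Φ k :=
  ∑ j ∈ sumTuples (k + 1) m N,
    adAction Φ k u (List.ofFn fun i => envElt Φ k xθ (j i)).prod

variable {ι : Type*}

/-- The equality `u · r_{(k+1)θ}(m) = ∑_Ψ c_Ψ X(Ψ)` of infinite sums in the completion of `𝒰`: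
modulo every left ideal `tailIdeal Φ k N` both sides are finite sums, and these agree. The terms
`X(Ψ)` for which some part of `Ψ` has degree at least `N` lie in `tailIdeal Φ k N`, as the parts
of largest degree are on the right of the product. -/
def IsExpansion (Φ : InvForm g) (k : ℕ) (xθ : g) (B : Module.Basis ι ℂ g) (o : PartOrder ι)
    (u : UniversalEnvelopingAlgebra ℂ g) (m : ℤ) (c : ColPart ι → ℂ) : Prop :=
  ∀ N : ℕ, ∃ s : Finset (ColPart ι),
    (∀ Ψ, Ψ ∈ s ↔ (∀ p ∈ Ψ, p.2 < N) ∧ c Ψ ≠ 0) ∧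
    relTrunc Φ k xθ u m N - ∑ Ψ ∈ s, c Ψ • envMonomial Φ k B o Ψ ∈ tailIdeal Φ k N

/-- The set `𝓡` of leading terms of the nonzero relations `r(m) = u · r_{(k+1)θ}(m)`, `u ∈ U(g)`,
`m ∈ ℤ`: the smallest `Φ` that occurs in `r(m) = ∑ c_Ψ X(Ψ)` with a coefficient `c_Φ ≠ 0`. -/
def leadingTerms (Φ : InvForm g) (k : ℕ) (xθ : g) (B : Module.Basis ι ℂ g) (o : PartOrder ι) :
    Set (ColPart ι) :=
  {Λ | ∃ (u : UniversalEnvelopingAlgebra ℂ g) (m : ℤ) (c : ColPart ι → ℂ),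
    IsExpansion Φ k xθ B o u m c ∧ c Λ ≠ 0 ∧ ∀ Ψ, c Ψ ≠ 0 → o.le Λ Ψ}

/-- The set `𝓓` of colored partitions that satisfy the difference conditions, i.e. that do not
contain any leading term. -/
def differenceSet (Φ : InvForm g) (k : ℕ) (xθ : g) (B : Module.Basis ι ℂ g) (o : PartOrder ι) :
    Set (ColPart ι) :=
  {P | ∀ Λ ∈ leadingTerms Φ k xθ B o, ¬ Λ ≤ P}

/-! ### The maximal root and the normalization of the form -/

section Root

variable [FiniteDimensional ℂ g] [LieAlgebra.IsSimple ℂ g]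
  {H : LieSubalgebra ℂ g} [H.IsCartanSubalgebra]

/-- `θ` is the maximal root with respect to the base `b` of the root system: `θ - α` is a sum of
simple roots for every root `α`. -/
def IsMaximalRoot (b : (LieAlgebra.IsKilling.rootSystem H).Base) (θ : H.root) : Prop :=
  ∀ α : H.root, (LieAlgebra.IsKilling.rootSystem H).root θ -
    (LieAlgebra.IsKilling.rootSystem H).root α ∈
      AddSubmonoid.closure ((LieAlgebra.IsKilling.rootSystem H).root '' b.support)

/-- `⟨θ, θ⟩ = 2` under the identification of `𝔥` with its dual by the form: the element `t ∈ 𝔥`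
with `⟨t, h⟩ = θ(h)` for all `h ∈ 𝔥` satisfies `⟨t, t⟩ = 2`. -/
def IsNormalized (Φ : InvForm g) (θ : H.root) : Prop :=
  ∃ t : H, (∀ h : H, Φ.form t h = (θ : LieModule.Weight ℂ H g) h) ∧ Φ.form t t = 2

end Root

end

end AffineStd

/-! The root vector of a maximal root normalized by ⟨θ, θ⟩ = 2 is extremal: [x, [x, y]] = -2⟨y, x⟩x
(`lie_lie_of_isMaximalRoot`). Let v be a vector killed by all y(i), i ≥ 0, and let R_n(m) be the sum
of x(j₁)⋯x(j_n)v over negative j_i of sum m. Extremality gives, for j ≥ 0, y(j)R_{n+1}(m) =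
y(0)R_{n+1}(m+j) + j(n+1)(k-n)⟨y, x⟩R_n(m+j) (`op_powVec`). For n = k the correction vanishes, so in
N(kΛ₀) the vectors R_{k+1}(m) generate a submodule on which d has only negative eigenvalues. It
misses the vacuum, hence lies in N¹(kΛ₀) (`exists_stable_submodule_not_mem`,
`uTildePow_smul_vacuum`).

As x(0)𝟏 = 0, the annihilator of 𝟏 in 𝒰 is stable under the adjoint action of g. Read modulo
`tailIdeal Φ k 0`, each expanded relation therefore becomes a finite linear relation among the X(Ψ)𝟏
with negative parts (`IsExpansion.sum_monomialVector`); a leading term with negative parts survives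
as its smallest member.

The spanning set is then reduced by a well-order argument (`monVec_mem_span`). Let P be the largest
partition whose vector is not in the desired span. Then P = ΨΛ with Λ a leading term, and X(Ψ)
applied to the relation of Λ expresses X(P)𝟏 through X(ΨQ)𝟏 with Q ≻ Λ and through shorter monomials
produced by reordering. All of these are larger than P, a contradiction. -/

namespace AffineStd
noncomputable section

open LieAlgebra TensorProduct

variable {g : Type*} [LieRing g] [LieAlgebra ℂ g]

/-! ### Extremality of the maximal root vector -/

section MaximalRoot

/-- The height functional, equal to 1 on every simple root, takes natural number values on the cone
and vanishes there only at 0. -/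
theorem _root_.RootPairing.Base.eq_zero_of_mem_closure_of_neg_mem_closure
    {ι R M N : Type*} [Field R] [CharZero R] [AddCommGroup M] [Module R M]
    [AddCommGroup N] [Module R N] {P : RootPairing ι R M N} [P.IsRootSystem] (b : P.Base) {x : M}
    (hx : x ∈ AddSubmonoid.closure (P.root '' b.support))
    (hx' : -x ∈ AddSubmonoid.closure (P.root '' b.support)) : x = 0 := by
  let f : M →ₗ[R] R := b.toWeightBasis.constr R fun _ => (1 : R)
  have key : ∀ y ∈ AddSubmonoid.closure (P.root '' b.support),
      ∃ n : ℕ, f y = n ∧ (n = 0 → y = 0) := by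
    intro y hy
    induction hy using AddSubmonoid.closure_induction with
    | mem y hy =>
      obtain ⟨i, hi, rfl⟩ := hy
      refine ⟨1, ?_, by simp⟩
      rw [← b.toWeightBasis_apply ⟨i, hi⟩, Module.Basis.constr_basis, Nat.cast_one]
    | zero => exact ⟨0, by simp⟩
    | add y z _ _ hy hz =>
      obtain ⟨m, hm, hm'⟩ := hy
      obtain ⟨n, hn, hn'⟩ := hz
      refine ⟨m + n, by simp [hm, hn], fun h => ?_⟩
      rw [hm' (by lia), hn' (by lia), add_zero]
  obtain ⟨m, hm, hm'⟩ := key x hx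
  obtain ⟨n, hn, -⟩ := key (-x) hx'
  rw [map_neg, hm, neg_eq_iff_add_eq_zero] at hn
  exact hm' (by norm_cast at hn; lia)

theorem InvForm.form_lie_left (Φ : InvForm g) (x y z : g) :
    Φ.form ⁅x, y⁆ z = Φ.form x ⁅y, z⁆ := by
  rw [← lie_skew, map_neg, LinearMap.neg_apply, Φ.inv, neg_neg]

variable [FiniteDimensional ℂ g] [LieAlgebra.IsSimple ℂ g]
  {H : LieSubalgebra ℂ g} [H.IsCartanSubalgebra]

theorem InvForm.form_eq_zero_of_mem_rootSpace (Φ : InvForm g) {α β : H → ℂ} (h : α + β ≠ 0)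
    {x y : g} (hx : x ∈ rootSpace H α) (hy : y ∈ rootSpace H β) : Φ.form x y = 0 := by
  obtain ⟨t, ht⟩ := Function.ne_iff.1 h
  have h1 := Φ.inv t x y
  have h2 : ⁅(t : g), x⁆ = α t • x := LieAlgebra.IsKilling.lie_eq_smul_of_mem_rootSpace hx t
  have h3 : ⁅(t : g), y⁆ = β t • y := LieAlgebra.IsKilling.lie_eq_smul_of_mem_rootSpace hy t
  rw [h2, h3, map_smul, map_smul, LinearMap.smul_apply, ← add_eq_zero_iff_eq_neg, ← add_smul] at h1
  exact (smul_eq_zero.1 h1).resolve_left ht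

/-- A root vector `xθ` for the maximal root is an extremal element of `g`. -/
theorem lie_lie_of_isMaximalRoot (b : (LieAlgebra.IsKilling.rootSystem H).Base) (θ : H.root)
    (hθ : IsMaximalRoot b θ) (Φ : InvForm g) (hΦ : IsNormalized Φ θ)
    (xθ : g) (hxθ : xθ ∈ LieAlgebra.rootSpace H (θ : LieModule.Weight ℂ H g)) (x : g) :
    ⁅xθ, ⁅xθ, x⁆⁆ = (-2 * Φ.form x xθ) • xθ := by
  have hθ0 : (θ : LieModule.Weight ℂ H g).IsNonZero := H.isNonZero_coe_root θ
  have hx : x ∈ (⨆ α : LieModule.Weight ℂ H g, LieModule.genWeightSpace g (α : H → ℂ)) := by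
    simp [LieModule.iSup_genWeightSpace_eq_top']
  induction hx using LieSubmodule.iSup_induction' with
  | zero => simp
  | add x y _ _ hx hy => rw [lie_add, lie_add, hx, hy, map_add, LinearMap.add_apply, ← add_smul,
      mul_add]
  | mem α x hx =>
  -- For weight α = -θ the bracket [xθ, x] lies in H, and θ of it is computed by invariance of the
  -- form with the dual vector t. For any other weight both sides vanish.
  by_cases h : (α : H → ℂ) + (θ : LieModule.Weight ℂ H g) = 0
  · have hα : (α : H → ℂ) = -((θ : LieModule.Weight ℂ H g) : H → ℂ) := eq_neg_of_add_eq_zero_left h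
    obtain ⟨t, ht, ht2⟩ := hΦ
    have h0 : ⁅xθ, x⁆ ∈ H.toLieSubmodule := by
      rw [← LieAlgebra.rootSpace_zero_eq ℂ g H, ← h, add_comm]
      exact LieAlgebra.lie_mem_genWeightSpace_of_mem_genWeightSpace hxθ hx
    have h1 : ⁅xθ, ⁅xθ, x⁆⁆ = -((θ : LieModule.Weight ℂ H g) ⟨_, h0⟩ • xθ) := by
      rw [← LieAlgebra.IsKilling.lie_eq_smul_of_mem_rootSpace hxθ, ← lie_skew]; rfl
    have h2 : ⁅x, (t : g)⁆ = (2 : ℂ) • x := by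
      rw [← ht2, ht, ← lie_skew]
      have : ⁅(t : g), x⁆ = α t • x := LieAlgebra.IsKilling.lie_eq_smul_of_mem_rootSpace hx t
      rw [this, hα, Pi.neg_apply, neg_smul, neg_neg]
    rw [h1, ← ht, ← neg_smul, Φ.symm.eq (t : g), Φ.form_lie_left, h2, map_smul, smul_eq_mul,
      Φ.symm.eq x xθ, neg_mul]
  · rw [Φ.form_eq_zero_of_mem_rootSpace h hx hxθ, mul_zero, zero_smul]
    by_contra hne
    have hmem : ⁅xθ, ⁅xθ, x⁆⁆ ∈ rootSpace H
        (((θ : LieModule.Weight ℂ H g) : H → ℂ) + ((θ : LieModule.Weight ℂ H g) + (α : H → ℂ))) :=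
      LieAlgebra.lie_mem_genWeightSpace_of_mem_genWeightSpace hxθ
        (LieAlgebra.lie_mem_genWeightSpace_of_mem_genWeightSpace hxθ hx)
    -- If the double bracket were nonzero, 2θ + α would be a weight. Neither α nor 2θ + α can be
    -- zero, since ±2θ is not a root, so maximality applies to the roots -α and β. It puts θ + α and
    -- -(θ + α) in the positive cone, forcing α = -θ.
    let β : LieModule.Weight ℂ H g :=
      ⟨((θ : LieModule.Weight ℂ H g) : H → ℂ) + ((θ : LieModule.Weight ℂ H g) + (α : H → ℂ)),
        fun hbot => hne (by rwa [rootSpace, hbot] at hmem)⟩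
    have hβ : (β : H → ℂ) =
      ((θ : LieModule.Weight ℂ H g) : H → ℂ) + ((θ : LieModule.Weight ℂ H g) + (α : H → ℂ)) := rfl
    have hα0 : α.IsNonZero := by
      intro h0
      have h0 : (α : H → ℂ) = 0 := h0
      rw [h0, add_zero, ← two_nsmul, LieAlgebra.IsKilling.rootSpace_two_smul _ hθ0] at hmem
      exact hne hmem
    have hβ0 : β.IsNonZero := by
      intro h0
      have h0 : (β : H → ℂ) = 0 := h0
      have h1 : (α : H → ℂ) = 2 • ((-(θ : LieModule.Weight ℂ H g) : LieModule.Weight ℂ H g)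
          : H → ℂ) := by
        rw [LieModule.Weight.coe_neg, two_nsmul, ← sub_eq_zero, ← h0, hβ]; abel
      change x ∈ rootSpace H (α : H → ℂ) at hx
      rw [h1, LieAlgebra.IsKilling.rootSpace_two_smul _ hθ0.neg] at hx
      exact hne (by rw [(LieSubmodule.mem_bot _).1 hx]; simp)
    have h1 := hθ ⟨-α, by simpa using hα0.neg⟩
    have h2 := hθ ⟨β, by simpa using hβ0⟩
    have h3 := b.eq_zero_of_mem_closure_of_neg_mem_closure h1 (by
      convert h2 using 1
      ext t
      simp only [LieAlgebra.IsKilling.rootSystem_root_apply]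
      change -(θ.1 t - (-α : LieModule.Weight ℂ H g) t) = θ.1 t - β t
      rw [hβ, LieModule.Weight.coe_neg]
      simp)
    refine h (funext fun t => ?_)
    have h4 : θ.1 t - (-α : LieModule.Weight ℂ H g) t = 0 := LinearMap.congr_fun h3 t
    rw [LieModule.Weight.coe_neg, Pi.neg_apply, sub_neg_eq_add] at h4
    rw [Pi.add_apply, add_comm, Pi.zero_apply, h4]

end MaximalRoot

/-! ### Coefficients of x(z)^n on a vacuum vector -/

section LevelAction

/-- An action of `ĝ` of level `k` on a vector space `V`, given by the operators `x(i)`. -/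
structure LevelAction (Φ : InvForm g) (k : ℂ) (V : Type*) [AddCommGroup V] [Module ℂ V] where
  op : ℤ → g →ₗ[ℂ] Module.End ℂ V
  comm : ∀ x y i j v, op i x (op j y v) =
    op j y (op i x v) + op (i + j) ⁅x, y⁆ v + (if i + j = 0 then (i : ℂ) * Φ.form x y * k else 0) • v

/-- The sum of the vectors `x(j₁) ⋯ x(j_n) v` with negative `j₁, …, j_n` of sum `m`. -/
def LevelAction.powVec {Φ : InvForm g} {k : ℂ} {V : Type*} [AddCommGroup V] [Module ℂ V]
    (A : LevelAction Φ k V) (x : g) (v : V) (n : ℕ) (m : ℤ) : V :=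
  ∑ j ∈ sumTuples n m 0, (List.ofFn fun i => A.op (j i) x).prod v

variable {Φ : InvForm g} {k : ℂ} {V : Type*} [AddCommGroup V] [Module ℂ V]
  (A : LevelAction Φ k V) (x : g) (v : V)

namespace LevelAction

theorem powVec_zero (m : ℤ) : A.powVec x v 0 m = if m = 0 then v else 0 := by
  have : sumTuples 0 m 0 = if m = 0 then Finset.univ else ∅ := by
    ext j
    rw [mem_sumTuples]
    split_ifs with h
    · simpa [h] using Subsingleton.elim _ _
    · simp [eq_comm, h]
  rw [powVec, this]
  split_ifs <;> simp

theorem powVec_of_pos (n : ℕ) {m : ℤ} (hm : 0 < m) : A.powVec x v n m = 0 := by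
  refine Finset.sum_eq_zero fun j hj => ?_
  rw [mem_sumTuples] at hj
  have : ∑ i : Fin n, j i ≤ 0 :=
    Finset.sum_nonpos fun i _ => by have := hj.1 i; push_cast at this; lia
  lia

/-- The sum is split by its leftmost factor x(-i-1). The cutoff `M` is free because the terms with i
≥ -m have an inner vector of positive degree, an empty sum; this freedom is what lets sums of
different degree be aligned. -/
theorem powVec_succ (n : ℕ) (m : ℤ) (M : ℕ) (hM : -m ≤ M) :
    A.powVec x v (n + 1) m =
      ∑ i ∈ Finset.range M, A.op (-i - 1) x (A.powVec x v n (m + i + 1)) := by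
  simp only [powVec, map_sum]
  rw [Finset.sum_sigma']
  refine Finset.sum_bij' (fun j _ => ⟨(-(j 0) - 1).toNat, fun i => j i.succ⟩)
    (fun p _ => Fin.cons (-(p.1 : ℤ) - 1) p.2) ?_ ?_ ?_ ?_ ?_
  · intro j hj
    rw [mem_sumTuples, Fin.sum_univ_succ] at hj
    have h0 := hj.1 0
    have h1 : ∑ i : Fin n, j i.succ ≤ 0 :=
      Finset.sum_nonpos fun i _ => by have := hj.1 i.succ; simp at this; lia
    simp only [Finset.mem_sigma, Finset.mem_range, mem_sumTuples]
    exact ⟨by lia, fun i => hj.1 i.succ, by lia⟩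
  · intro p hp
    simp only [Finset.mem_sigma, Finset.mem_range, mem_sumTuples] at hp
    rw [mem_sumTuples, Fin.sum_univ_succ]
    refine ⟨fun i => ?_, by simp only [Fin.cons_zero, Fin.cons_succ]; lia⟩
    refine Fin.cases ?_ (fun i => ?_) i
    · rw [Fin.cons_zero]; push_cast; lia
    · rw [Fin.cons_succ]; exact hp.2.1 i
  · intro j hj
    have h0 := (mem_sumTuples.1 hj).1 0
    funext i
    refine Fin.cases ?_ (fun i => ?_) i
    · rw [Fin.cons_zero]; push_cast at h0 ⊢; lia
    · rw [Fin.cons_succ]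
  · rintro ⟨i, j⟩ _
    simp
  · intro j hj
    have h0 := (mem_sumTuples.1 hj).1 0
    have h1 : -(((-(j 0) - 1).toNat : ℕ) : ℤ) - 1 = j 0 := by push_cast at h0; lia
    simp only [h1, List.ofFn_succ, List.prod_cons, Module.End.mul_apply]

variable {x v} (hv : ∀ (y : g) (i : ℤ), 0 ≤ i → A.op i y v = 0)
include hv

/-- The operators x(i) commute with one another when ⟨x, x⟩ = 0, so x(i) moves through to `v`. -/
theorem op_self_powVec (hxx : Φ.form x x = 0) (n : ℕ) (m : ℤ) (i : ℤ) (hi : 0 ≤ i) :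
    A.op i x (A.powVec x v n m) = 0 := by
  induction n generalizing m with
  | zero => rw [powVec_zero]; split_ifs <;> simp [hv x i hi]
  | succ n ih =>
    rw [A.powVec_succ x v n m (-m).toNat (by lia), map_sum]
    refine Finset.sum_eq_zero fun l _ => ?_
    rw [A.comm, ih, hxx]
    simp

variable (hx : ∀ y, ⁅x, ⁅x, y⁆⁆ = (-2 * Φ.form y x) • x)
include hx

/-- Passing [y, x](i) through x(-l-1) leaves -2⟨y, x⟩x(i-l-1), with no central term since ⟨[y, x],
x⟩ = 0. For l < i this is a nonnegative mode of x and kills the rest; the terms l ≥ i reassemble the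
sum in degree m + i. -/
theorem op_lie_powVec (hxx : Φ.form x x = 0) (y : g) (n : ℕ) (m : ℤ) (i : ℕ) :
    A.op i ⁅y, x⁆ (A.powVec x v n m) = (n * (-2 * Φ.form y x)) • A.powVec x v n (m + i) := by
  have hyx : ⁅⁅y, x⁆, x⁆ = (-2 * Φ.form y x) • x := by
    rw [← hx, ← lie_skew, ← lie_skew x y, lie_neg]
  have h0 : Φ.form ⁅y, x⁆ x = 0 := by rw [Φ.form_lie_left]; simp
  induction n generalizing m with
  | zero => rw [powVec_zero]; split_ifs <;> simp [hv _ i (by lia)]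
  | succ n ih =>
    rw [A.powVec_succ x v n m (i + (-m).toNat) (by lia),
      A.powVec_succ x v n (m + i) (-m).toNat (by lia), map_sum]
    have h : ∀ l ∈ Finset.range (i + (-m).toNat),
        A.op i ⁅y, x⁆ (A.op (-l - 1) x (A.powVec x v n (m + l + 1))) =
        (n * (-2 * Φ.form y x)) • A.op (-l - 1) x (A.powVec x v n (m + i + l + 1)) +
        (-2 * Φ.form y x) • A.op (i + (-l - 1)) x (A.powVec x v n (m + l + 1)) := by
      intro l _
      rw [A.comm, ih, h0, hyx]
      simp only [map_smul, LinearMap.smul_apply, mul_zero, zero_mul, ite_self, zero_smul, add_zero]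
      congr 4; ring
    rw [Finset.sum_congr rfl h, Finset.sum_add_distrib, ← Finset.smul_sum, ← Finset.smul_sum,
      ← A.powVec_succ x v n (m + i) (i + (-m).toNat) (by lia),
      Finset.sum_range_add, Finset.sum_eq_zero (s := Finset.range i), zero_add,
      A.powVec_succ x v n (m + i) (-m).toNat (by lia)]
    · have : ∀ l : ℕ, A.op (i + (-((i + l : ℕ) : ℤ) - 1)) x
          (A.powVec x v n (m + (i + l : ℕ) + 1)) =
          A.op (-l - 1) x (A.powVec x v n (m + i + l + 1)) := by
        intro l
        congr 3 <;> push_cast <;> ring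
      rw [Finset.sum_congr rfl fun l _ => this l, ← add_smul]
      congr 1
      push_cast; ring
    · intro l hl
      exact A.op_self_powVec hv hxx n _ _ (by have := Finset.mem_range.1 hl; lia)

/-- The coefficient at which the level enters: it vanishes exactly at n = k for generic j and y. It
comes from the recursion n(k-n+1) + (k-2n) = (n+1)(k-n). -/
theorem op_powVec (hxx : Φ.form x x = 0) (y : g) (n : ℕ) (m : ℤ) (j : ℕ) :
    A.op j y (A.powVec x v (n + 1) m) = A.op 0 y (A.powVec x v (n + 1) (m + j)) +
      (j * (n + 1) * (k - n) * Φ.form y x) • A.powVec x v n (m + j) := by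
  -- One more factor x(-l-1) adds j(k-2n)⟨y, x⟩: the central term contributes jk, and each of the j
  -- commutators with l < j contributes -2n.
  have step : ∀ (n : ℕ) (r : ℤ → V), (∀ m, A.op j y (A.powVec x v n m) =
      A.op 0 y (A.powVec x v n (m + j)) + r m) → ∀ m : ℤ,
      A.op j y (A.powVec x v (n + 1) m) = A.op 0 y (A.powVec x v (n + 1) (m + j)) +
      (∑ l ∈ Finset.range (j + (-m).toNat), A.op (-l - 1) x (r (m + l + 1))) +
      (j * (k - 2 * n) * Φ.form y x) • A.powVec x v n (m + j) := by
    intro n r h m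
    have hlow : ∀ l ∈ Finset.range j,
        A.op (j + (-l - 1)) ⁅y, x⁆ (A.powVec x v n (m + l + 1)) =
          (n * (-2 * Φ.form y x)) • A.powVec x v n (m + j) := by
      intro l hl
      have hl := Finset.mem_range.1 hl
      have h1 : (j : ℤ) + (-l - 1) = ((j - 1 - l : ℕ) : ℤ) := by lia
      rw [h1, A.op_lie_powVec hv hx hxx]
      congr 2; lia
    -- The commutators with l ≥ j, shifted by j, are exactly those occurring in the expansion of
    -- y(0) on the vector of degree m + j.
    have hhigh : ∀ l : ℕ, A.op (j + (-((j + l : ℕ) : ℤ) - 1)) ⁅y, x⁆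
        (A.powVec x v n (m + (j + l : ℕ) + 1)) =
        A.op (0 + (-l - 1)) ⁅y, x⁆ (A.powVec x v n (m + j + l + 1)) := by
      intro l
      congr 3 <;> push_cast <;> ring
    have hc : ∑ l ∈ Finset.range (j + (-m).toNat),
        ((if (j : ℤ) + (-l - 1) = 0 then (j : ℤ) * Φ.form y x * k else 0) : ℂ) •
          A.powVec x v n (m + l + 1) = (j * Φ.form y x * k) • A.powVec x v n (m + j) := by
      rcases Nat.eq_zero_or_pos j with rfl | hj
      · simp
      -- The central term occurs only for x(-j), that is l = j - 1.
      rw [Finset.sum_eq_single (j - 1)]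
      · rw [if_pos (by lia)]
        congr 2; lia
      · intro l _ hl
        rw [if_neg (by lia), zero_smul]
      · intro hl
        exact absurd (Finset.mem_range.2 (by lia)) hl
    have h0 : A.op 0 y (A.powVec x v (n + 1) (m + j)) =
        ∑ l ∈ Finset.range (j + (-m).toNat),
          A.op (-l - 1) x (A.op 0 y (A.powVec x v n (m + j + l + 1))) +
        ∑ l ∈ Finset.range (-m).toNat,
          A.op (0 + (-l - 1)) ⁅y, x⁆ (A.powVec x v n (m + j + l + 1)) := by
      rw [A.powVec_succ x v n (m + j) (-m).toNat (by lia), map_sum, add_comm j,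
        Finset.sum_range_add _ (-m).toNat j,
        Finset.sum_eq_zero (s := Finset.range j), add_zero, ← Finset.sum_add_distrib]
      · refine Finset.sum_congr rfl fun l _ => ?_
        rw [A.comm]
        simp
      · intro l _
        rw [A.powVec_of_pos x v n (by lia), map_zero, map_zero]
    have hsplit : ∀ l : ℕ, A.op j y (A.op (-l - 1) x (A.powVec x v n (m + l + 1))) =
        A.op (-l - 1) x (A.op 0 y (A.powVec x v n (m + j + l + 1))) +
        A.op (-l - 1) x (r (m + l + 1)) +
        A.op (j + (-l - 1)) ⁅y, x⁆ (A.powVec x v n (m + l + 1)) +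
        ((if (j : ℤ) + (-l - 1) = 0 then (j : ℤ) * Φ.form y x * k else 0) : ℂ) •
          A.powVec x v n (m + l + 1) := by
      intro l
      rw [A.comm, h, map_add]
      congr 6; ring
    rw [A.powVec_succ x v n m (j + (-m).toNat) (by lia), map_sum,
      Finset.sum_congr rfl fun l _ => hsplit l, Finset.sum_add_distrib, Finset.sum_add_distrib,
      Finset.sum_add_distrib, hc, h0,
      Finset.sum_range_add (fun l : ℕ => A.op (j + (-l - 1)) ⁅y, x⁆ (A.powVec x v n (m + l + 1))),
      Finset.sum_congr rfl hlow, Finset.sum_congr rfl fun l _ => hhigh l, Finset.sum_const,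
      Finset.card_range]
    module
  induction n generalizing m with
  | zero =>
    rw [step 0 (fun _ => 0) fun m => ?_]
    · simp only [map_zero, Finset.sum_const_zero, add_zero]
      congr 2
      push_cast; ring
    · simp only [powVec_zero]
      split_ifs <;> simp [hv _ j (by lia), hv y 0 le_rfl]
  | succ n ih =>
    rw [step (n + 1) _ ih]
    have h1 : ∀ l : ℕ, A.op (-l - 1) x ((j * (n + 1) * (k - n) * Φ.form y x) •
        A.powVec x v n (m + l + 1 + j)) = (j * (n + 1) * (k - n) * Φ.form y x) •
        A.op (-l - 1) x (A.powVec x v n (m + j + l + 1)) := by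
      intro l
      rw [map_smul]
      congr 3; ring
    rw [Finset.sum_congr rfl fun l _ => h1 l, ← Finset.smul_sum,
      ← A.powVec_succ x v n (m + j) _ (by lia), add_assoc, ← add_smul]
    congr 2
    push_cast; ring

/-- The submodule is generated from the coefficients by nonpositive modes only. Then degrees can
only drop, so `D` has negative eigenvalues on it, while stability under positive modes follows from
the vanishing correction in `op_powVec`. -/
theorem exists_stable_submodule_not_mem (K : ℕ) (hK : k = K) (hx0 : x ≠ 0) (D : Module.End ℂ V)
    (hD : ∀ i y w, D (A.op i y w) = A.op i y (D w) + (i : ℂ) • A.op i y w) (hDv : D v = 0)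
    (hv0 : v ≠ 0) :
    ∃ p : Submodule ℂ V, (∀ m, A.powVec x v (K + 1) m ∈ p) ∧
      (∀ i y, ∀ w ∈ p, A.op i y w ∈ p) ∧ (∀ w ∈ p, D w ∈ p) ∧ v ∉ p := by
  have hxx : Φ.form x x = 0 := by
    have h := hx x
    rw [lie_self, lie_zero, eq_comm, smul_eq_zero] at h
    simpa using h.resolve_right hx0
  let C : Set (Submodule ℂ V) :=
    {p | (∀ m, A.powVec x v (K + 1) m ∈ p) ∧ ∀ (i : ℤ) y, i ≤ 0 → ∀ w ∈ p, A.op i y w ∈ p}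
  let p : Submodule ℂ V := sInf C
  have hp : p ∈ C := by
    refine ⟨fun m => ?_, fun i y hi w hw => ?_⟩
    · exact (Submodule.mem_sInf).2 fun q hq => hq.1 m
    · exact (Submodule.mem_sInf).2 fun q hq => hq.2 i y hi w ((Submodule.mem_sInf).1 hw q hq)
  -- By minimality of `p` it suffices that the vectors of `p` sent into `p` by all nonnegative modes
  -- again form a member of `C`.
  have hpos : p ≤ p ⊓ ⨅ (j : ℕ) (y : g), p.comap (A.op j y) := by
    refine sInf_le ⟨fun m => ?_, fun i y hi w hw => ?_⟩
    · simp only [Submodule.mem_inf, Submodule.mem_iInf, Submodule.mem_comap]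
      refine ⟨hp.1 m, fun j y => ?_⟩
      rw [A.op_powVec hv hx hxx, sub_eq_zero.2 hK, mul_zero, zero_mul, zero_smul, add_zero]
      exact hp.2 0 y le_rfl _ (hp.1 _)
    · simp only [Submodule.mem_inf, Submodule.mem_iInf, Submodule.mem_comap] at hw ⊢
      refine ⟨hp.2 i y hi w hw.1, fun j z => ?_⟩
      rw [A.comm]
      refine add_mem (add_mem (hp.2 i y hi _ (hw.2 j z)) ?_) (p.smul_mem _ hw.1)
      -- The commutator has mode j + i: if nonpositive, `p` is stable under it by construction;
      -- otherwise the assumption on `w` covers it.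
      rcases le_total ((j : ℤ) + i) 0 with h | h
      · exact hp.2 _ _ h _ hw.1
      · obtain ⟨l, hl⟩ := Int.eq_ofNat_of_zero_le h
        rw [hl]
        exact hw.2 l _
  have hDR : ∀ n m, D (A.powVec x v n m) = (m : ℂ) • A.powVec x v n m := by
    intro n
    induction n with
    | zero => intro m; rw [powVec_zero]; split_ifs with h <;> simp [h, hDv]
    | succ n ih =>
      intro m
      rw [A.powVec_succ x v n m (-m).toNat (by lia), map_sum, Finset.smul_sum]
      refine Finset.sum_congr rfl fun l _ => ?_
      rw [hD, ih, map_smul, ← add_smul]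
      congr 1
      push_cast; ring
  have hDp : p ≤ p ⊓ p.comap D := by
    refine sInf_le ⟨fun m => ⟨hp.1 m, ?_⟩, fun i y hi w hw => ⟨hp.2 i y hi w hw.1, ?_⟩⟩
    · rw [SetLike.mem_coe, Submodule.mem_comap, hDR]
      exact p.smul_mem _ (hp.1 m)
    · rw [SetLike.mem_coe, Submodule.mem_comap, hD]
      exact add_mem (hp.2 i y hi _ hw.2) (p.smul_mem _ (hp.2 i y hi w hw.1))
  have hneg : p ≤ ⨆ n : ℕ, D.eigenspace (-(n + 1)) := by
    refine sInf_le ⟨fun m => ?_, fun i y hi w hw => ?_⟩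
    · rcases le_or_gt 0 m with h | h
      · rw [A.powVec_succ x v K m 0 (by simpa using h), Finset.sum_range_zero]
        exact zero_mem _
      · refine Submodule.mem_iSup_of_mem (-m - 1).toNat ?_
        rw [Module.End.mem_eigenspace_iff, hDR]
        congr 1
        have : (((-m - 1).toNat : ℕ) : ℤ) = -m - 1 := by lia
        have : (((-m - 1).toNat : ℕ) : ℂ) = -m - 1 := by exact_mod_cast this
        rw [this]; ring
    · induction hw using Submodule.iSup_induction' with
      | zero => rw [map_zero]; exact zero_mem _
      | add a b _ _ ha hb => rw [map_add]; exact add_mem ha hb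
      | mem n a ha =>
        refine Submodule.mem_iSup_of_mem (n + (-i).toNat) ?_
        rw [Module.End.mem_eigenspace_iff] at ha ⊢
        rw [hD, ha, map_smul, ← add_smul]
        congr 1
        have : (((-i).toNat : ℕ) : ℤ) = -i := by lia
        have : (((-i).toNat : ℕ) : ℂ) = -i := by exact_mod_cast this
        push_cast
        rw [this]; ring
  refine ⟨p, hp.1, fun i y w hw => ?_, fun w hw => (hDp hw).2, fun h => hv0 ?_⟩
  · rcases le_total i 0 with h | h
    · exact hp.2 i y h w hw
    · obtain ⟨l, rfl⟩ := Int.eq_ofNat_of_zero_le h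
      have := (hpos hw).2
      simp only [SetLike.mem_coe, Submodule.mem_iInf, Submodule.mem_comap] at this
      exact this l y
  -- The vector `v` has eigenvalue 0, and eigenspaces of distinct eigenvalues are independent.
  · refine (Submodule.disjoint_def.1 (D.eigenspaces_iSupIndep 0)) v ?_ ?_
    · rw [Module.End.mem_eigenspace_iff, hDv, zero_smul]
    · refine (iSup_le fun n => ?_ :
        (⨆ n : ℕ, D.eigenspace (-(n + 1))) ≤ ⨆ j, ⨆ (_ : j ≠ 0), D.eigenspace j) (hneg h)
      exact le_iSup₂_of_le (-(n + 1 : ℂ))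
        (neg_ne_zero.2 (Nat.cast_add_one_ne_zero n)) le_rfl

end LevelAction
end LevelAction

/-! ### Modules over the affine algebra as level actions -/

section TildeModules

attribute [local instance 100] LieRing.ofAssociativeRing

/-- The elements satisfying `p` form a subalgebra containing the Lie algebra; by the universal
property the identity factors through it. -/
theorem _root_.UniversalEnvelopingAlgebra.induction {R L : Type*} [CommRing R] [LieRing L]
    [LieAlgebra R L] {p : UniversalEnvelopingAlgebra R L → Prop}
    (algebraMap : ∀ r, p (algebraMap R _ r))
    (ι : ∀ x, p (UniversalEnvelopingAlgebra.ι R x))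
    (mul : ∀ a b, p a → p b → p (a * b)) (add : ∀ a b, p a → p b → p (a + b))
    (a : UniversalEnvelopingAlgebra R L) : p a := by
  let S : Subalgebra R (UniversalEnvelopingAlgebra R L) :=
    { carrier := {a | p a}
      mul_mem' := fun {a b} ha hb => mul a b ha hb
      add_mem' := fun {a b} ha hb => add a b ha hb
      algebraMap_mem' := algebraMap }
  let f : L →ₗ⁅R⁆ S :=
    { toFun := fun x => ⟨UniversalEnvelopingAlgebra.ι R x, ι x⟩
      map_add' := fun x y => Subtype.ext (map_add _ x y)
      map_smul' := fun r x => Subtype.ext (map_smul _ r x)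
      map_lie' := fun {x y} => Subtype.ext (LieHom.map_lie _ x y) }
  have h : S.val.comp (UniversalEnvelopingAlgebra.lift R f) = AlgHom.id R _ := by
    ext x
    change ((UniversalEnvelopingAlgebra.lift R f (UniversalEnvelopingAlgebra.ι R x) : S) :
      UniversalEnvelopingAlgebra R L) = _
    rw [UniversalEnvelopingAlgebra.lift_ι_apply]
    rfl
  have h' := DFunLike.congr_fun h a
  rw [AlgHom.id_apply] at h'
  rw [← h']
  exact (UniversalEnvelopingAlgebra.lift R f a).2

variable (Φ : InvForm g)

/-- The image of `c` in `U(g̃)`. -/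
def uTildeC : UniversalEnvelopingAlgebra ℂ (Tilde Φ) :=
  UniversalEnvelopingAlgebra.ι ℂ (hatToTilde Φ (hatC Φ))

/-- The image of `d` in `U(g̃)`. -/
def uTildeD : UniversalEnvelopingAlgebra ℂ (Tilde Φ) :=
  UniversalEnvelopingAlgebra.ι ℂ (tildeD Φ)

/-- The linear map `x ↦ x(i)`. -/
def hatEltLin (i : ℤ) : g →ₗ[ℂ] Hat Φ :=
  ofLoop Φ ∘ₗ TensorProduct.mk ℂ _ g (AddMonoidAlgebra.single i 1)

/-- The linear map `x ↦ x(i)` to `U(g̃)`. -/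
def uTildeLin (i : ℤ) : g →ₗ[ℂ] UniversalEnvelopingAlgebra ℂ (Tilde Φ) :=
  (UniversalEnvelopingAlgebra.ι ℂ (L := Tilde Φ)).toLinearMap ∘ₗ (hatToTilde Φ).toLinearMap ∘ₗ
    hatEltLin Φ i

theorem _root_.UniversalEnvelopingAlgebra.ι_mul_ι {R L : Type*} [CommRing R] [LieRing L]
    [LieAlgebra R L] (x y : L) :
    UniversalEnvelopingAlgebra.ι R x * UniversalEnvelopingAlgebra.ι R y =
      UniversalEnvelopingAlgebra.ι R y * UniversalEnvelopingAlgebra.ι R x +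
        UniversalEnvelopingAlgebra.ι R ⁅x, y⁆ := by
  rw [LieHom.map_lie, LieRing.of_associative_ring_bracket]; abel

theorem uTildeElt_mul (x y : g) (i j : ℤ) :
    uTildeElt Φ x i * uTildeElt Φ y j = uTildeElt Φ y j * uTildeElt Φ x i +
      uTildeElt Φ ⁅x, y⁆ (i + j) +
        (if i + j = 0 then (i : ℂ) * Φ.form x y else 0) • uTildeC Φ := by
  rw [uTildeElt, uTildeElt, UniversalEnvelopingAlgebra.ι_mul_ι, ← LieHom.map_lie, hatElt_lie,
    map_add, map_add, map_smul, map_smul, add_assoc]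
  rfl

theorem uTildeD_mul (x : g) (i : ℤ) :
    uTildeD Φ * uTildeElt Φ x i = uTildeElt Φ x i * uTildeD Φ + (i : ℂ) • uTildeElt Φ x i := by
  rw [uTildeElt, uTildeD, UniversalEnvelopingAlgebra.ι_mul_ι, tildeD_lie, map_smul]

theorem hat_eq (a : Hat Φ) : ∃ (l : loopAlgebra ℂ ℤ g) (z : ℂ), a = ofLoop Φ l + z • hatC Φ := by
  refine ⟨((ofProd _).symm a).1, TrivialLieModule.equiv ℂ _ ℂ ((ofProd _).symm a).2, ?_⟩
  rw [hatC, ofLoop, ← of_smul, LinearMap.coe_mk, AddHom.coe_mk, ← of_add]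
  rw [← Equiv.symm_apply_eq]
  refine Prod.ext (by simp) ?_
  rw [Prod.snd_add, Prod.smul_snd, zero_add, ← map_smul, smul_eq_mul, mul_one,
    LinearEquiv.symm_apply_apply]

theorem tilde_eq (a : Tilde Φ) : a = hatToTilde Φ a.left + a.right • tildeD Φ := by
  refine SemiDirectSum.ext ?_ ?_
  · simp [tildeD, hatToTilde]
  · simp [tildeD, hatToTilde]

theorem tilde_induction {p : Tilde Φ → Prop} (add : ∀ a b, p a → p b → p (a + b))
    (smul : ∀ (r : ℂ) a, p a → p (r • a))
    (elt : ∀ x i, p (hatToTilde Φ (hatElt Φ x i))) (c : p (hatToTilde Φ (hatC Φ)))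
    (d : p (tildeD Φ)) (a : Tilde Φ) : p a := by
  obtain ⟨l, z, hl⟩ := hat_eq Φ a.left
  rw [tilde_eq Φ a, hl, map_add, map_smul]
  refine add _ _ (add _ _ ?_ (smul _ _ c)) (smul _ _ d)
  clear hl
  induction l using loop_induction with
  | zero => simpa using smul 0 _ d
  | add a b ha hb => rw [map_add, map_add]; exact add _ _ ha hb
  | elt x i => exact elt x i

theorem uTildeC_mul (u : UniversalEnvelopingAlgebra ℂ (Tilde Φ)) :
    uTildeC Φ * u = u * uTildeC Φ := by
  induction u using UniversalEnvelopingAlgebra.induction with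
  | algebraMap r => exact (Algebra.commutes r _).symm
  | mul a b ha hb => rw [← mul_assoc, ha, mul_assoc, hb, mul_assoc]
  | add a b ha hb => rw [mul_add, ha, hb, add_mul]
  | ι x =>
    induction x using tilde_induction with
    | add a b ha hb => rw [map_add, mul_add, ha, hb, add_mul]
    | smul r a ha => rw [map_smul, mul_smul_comm, ha, smul_mul_assoc]
    | elt x i =>
      rw [uTildeC, UniversalEnvelopingAlgebra.ι_mul_ι, ← LieHom.map_lie, hatC_lie, map_zero,
        map_zero, add_zero]
    | c => rfl
    | d =>
      rw [uTildeC, ← sub_eq_zero, ← sub_eq_zero.2 (UniversalEnvelopingAlgebra.ι_mul_ι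
        (hatToTilde Φ (hatC Φ)) (tildeD Φ))]
      have : ⁅hatToTilde Φ (hatC Φ), tildeD Φ⁆ = 0 := by
        refine SemiDirectSum.ext ?_ ?_
        · change ⁅hatC Φ, (0 : Hat Φ)⁆ + (dAction Φ 0) 0 -
            ((1 : ℂ) • hatD Φ) (hatC Φ) = 0
          rw [lie_zero, map_zero, one_smul, zero_add, zero_sub, neg_eq_zero]
          change ofLoop Φ (loopD 0) = 0
          rw [map_zero, map_zero]
        · simp [tildeD, hatToTilde]
      rw [this, map_zero, add_zero]

variable {Φ} {M : Type*} [AddCommGroup M] [Module (UniversalEnvelopingAlgebra ℂ (Tilde Φ)) M]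
  [Module ℂ M] [IsScalarTower ℂ (UniversalEnvelopingAlgebra ℂ (Tilde Φ)) M]

theorem smul_mem_of_stable (p : Submodule ℂ M) (elt : ∀ x i, ∀ w ∈ p, uTildeElt Φ x i • w ∈ p)
    (c : ∀ w ∈ p, uTildeC Φ • w ∈ p) (d : ∀ w ∈ p, uTildeD Φ • w ∈ p)
    (u : UniversalEnvelopingAlgebra ℂ (Tilde Φ)) : ∀ w ∈ p, u • w ∈ p := by
  induction u using UniversalEnvelopingAlgebra.induction with
  | algebraMap r => intro w hw; rw [algebraMap_smul]; exact p.smul_mem r hw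
  | mul a b ha hb => intro w hw; rw [mul_smul]; exact ha _ (hb w hw)
  | add a b ha hb => intro w hw; rw [add_smul]; exact add_mem (ha w hw) (hb w hw)
  | ι x =>
    induction x using tilde_induction with
    | add a b ha hb => intro w hw; rw [map_add, add_smul]; exact add_mem (ha w hw) (hb w hw)
    | smul r a ha => intro w hw; rw [map_smul, smul_assoc]; exact p.smul_mem r (ha w hw)
    | elt x i => exact elt x i
    | c => exact c
    | d => exact d

/-- The action of `ĝ` on a `g̃`-module on which `c` acts by `k`. -/
def tildeLevelAction {k : ℂ} (hc : ∀ w : M, uTildeC Φ • w = k • w) : LevelAction Φ k M where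
  op i := (Algebra.lsmul ℂ ℂ M).toLinearMap ∘ₗ uTildeLin Φ i
  comm x y i j v := by
    change uTildeElt Φ x i • uTildeElt Φ y j • v = uTildeElt Φ y j • uTildeElt Φ x i • v +
      uTildeElt Φ ⁅x, y⁆ (i + j) • v + _
    rw [← mul_smul, uTildeElt_mul, add_smul, add_smul, mul_smul, smul_assoc, hc, ← mul_smul]
    split_ifs <;> simp [mul_smul]

theorem tildeLevelAction_op {k : ℂ} (hc : ∀ w : M, uTildeC Φ • w = k • w) (i : ℤ) (x : g) (w : M) :
    (tildeLevelAction hc).op i x w = uTildeElt Φ x i • w := rfl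

end TildeModules

/-! ### Relations annihilating the vacuum of the standard module -/

section Vacuum

attribute [local instance 100] LieRing.ofAssociativeRing

variable (Φ : InvForm g) (k : ℕ)

/-- The vacuum vector of the generalized Verma module. -/
def vermaVacuum : GenVerma Φ k := Submodule.Quotient.mk 1

theorem smul_vermaVacuum (u : UniversalEnvelopingAlgebra ℂ (Tilde Φ)) :
    u • vermaVacuum Φ k = Submodule.Quotient.mk u := by
  rw [vermaVacuum, ← Submodule.Quotient.mk_smul, smul_eq_mul, mul_one]

theorem smul_vermaVacuum_eq_zero {u : UniversalEnvelopingAlgebra ℂ (Tilde Φ)}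
    (hu : u ∈ vacuumIdeal Φ k) : u • vermaVacuum Φ k = 0 := by
  rw [smul_vermaVacuum, Submodule.Quotient.mk_eq_zero]
  exact hu

theorem uTildeElt_smul_vermaVacuum (x : g) {i : ℤ} (hi : 0 ≤ i) :
    uTildeElt Φ x i • vermaVacuum Φ k = 0 :=
  smul_vermaVacuum_eq_zero Φ k (Ideal.subset_span (Or.inl ⟨x, i, hi, rfl⟩))

theorem uTildeD_smul_vermaVacuum : uTildeD Φ • vermaVacuum Φ k = 0 :=
  smul_vermaVacuum_eq_zero Φ k (Ideal.subset_span (Or.inr (Or.inl rfl)))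

theorem uTildeC_smul_verma (w : GenVerma Φ k) : uTildeC Φ • w = (k : ℂ) • w := by
  obtain ⟨u, rfl⟩ := Submodule.Quotient.mk_surjective _ w
  have h : (uTildeC Φ - algebraMap ℂ _ (k : ℂ)) • vermaVacuum Φ k = 0 :=
    smul_vermaVacuum_eq_zero Φ k (Ideal.subset_span (Or.inr (Or.inr rfl)))
  rw [sub_smul, sub_eq_zero, algebraMap_smul] at h
  rw [← smul_vermaVacuum, ← mul_smul, uTildeC_mul, mul_smul, h, smul_comm]

theorem vacuum_eq : vacuum Φ k = Submodule.Quotient.mk (vermaVacuum Φ k) := rfl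

theorem uTildeElt_smul_vacuum (x : g) {i : ℤ} (hi : 0 ≤ i) :
    uTildeElt Φ x i • vacuum Φ k = 0 := by
  rw [vacuum_eq, ← Submodule.Quotient.mk_smul, uTildeElt_smul_vermaVacuum Φ k x hi,
    Submodule.Quotient.mk_zero]

theorem uTildeD_smul_vacuum : uTildeD Φ • vacuum Φ k = 0 := by
  rw [vacuum_eq, ← Submodule.Quotient.mk_smul, uTildeD_smul_vermaVacuum,
    Submodule.Quotient.mk_zero]

theorem uTildeC_smul_std (w : StdModule Φ k) : uTildeC Φ • w = (k : ℂ) • w := by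
  obtain ⟨w, rfl⟩ := Submodule.Quotient.mk_surjective _ w
  rw [← Submodule.Quotient.mk_smul, uTildeC_smul_verma, Submodule.Quotient.mk_smul]

theorem exists_smul_vacuum (w : StdModule Φ k) :
    ∃ u : UniversalEnvelopingAlgebra ℂ (Tilde Φ), w = u • vacuum Φ k := by
  obtain ⟨w, rfl⟩ := Submodule.Quotient.mk_surjective _ w
  obtain ⟨u, rfl⟩ := Submodule.Quotient.mk_surjective _ w
  exact ⟨u, by rw [vacuum_eq, ← Submodule.Quotient.mk_smul, smul_vermaVacuum]⟩

/-- The element of `U(g̃)` given by the terms of `∑ x(j₁) ⋯ x(j_n)` with negative degrees. -/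
def uTildePow (x : g) (n : ℕ) (m : ℤ) : UniversalEnvelopingAlgebra ℂ (Tilde Φ) :=
  ∑ j ∈ sumTuples n m 0, (List.ofFn fun i => uTildeElt Φ x (j i)).prod

theorem powVec_tildeLevelAction {M : Type*} [AddCommGroup M]
    [Module (UniversalEnvelopingAlgebra ℂ (Tilde Φ)) M]
    [Module ℂ M] [IsScalarTower ℂ (UniversalEnvelopingAlgebra ℂ (Tilde Φ)) M]
    {c : ℂ} (hc : ∀ w : M, uTildeC Φ • w = c • w) (x : g) (v : M) (n : ℕ) (m : ℤ) :
    (tildeLevelAction hc).powVec x v n m = uTildePow Φ x n m • v := by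
  rw [LevelAction.powVec, uTildePow, Finset.sum_smul]
  refine Finset.sum_congr rfl fun j _ => ?_
  change _ = Algebra.lsmul ℂ ℂ M (List.ofFn fun i => uTildeElt Φ x (j i)).prod v
  rw [map_list_prod, List.map_ofFn]
  rfl

/-- The field `x_θ(z)^{k+1}` annihilates the vacuum of the standard module. -/
theorem uTildePow_smul_vacuum {x : g} (hx0 : x ≠ 0)
    (hx : ∀ y, ⁅x, ⁅x, y⁆⁆ = (-2 * Φ.form y x) • x) (m : ℤ) :
    uTildePow Φ x (k + 1) m • vacuum Φ k = 0 := by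
  rw [vacuum_eq, ← Submodule.Quotient.mk_smul, Submodule.Quotient.mk_eq_zero]
  -- This case split avoids proving that the generalized Verma module is nonzero.
  by_cases hv0 : vermaVacuum Φ k = 0
  · rw [hv0, smul_zero]; exact zero_mem _
  obtain ⟨p, hpR, hpA, hpD, hpv⟩ :=
    (tildeLevelAction (uTildeC_smul_verma Φ k)).exists_stable_submodule_not_mem
    (v := vermaVacuum Φ k) (fun y i hi => uTildeElt_smul_vermaVacuum Φ k y hi) hx k rfl hx0
    (Algebra.lsmul ℂ ℂ _ (uTildeD Φ)) (fun i y w => by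
      simp only [Algebra.lsmul_coe, tildeLevelAction_op]
      rw [← mul_smul, uTildeD_mul, add_smul, mul_smul, smul_assoc])
    (uTildeD_smul_vermaVacuum Φ k) hv0
  let q : Submodule (UniversalEnvelopingAlgebra ℂ (Tilde Φ)) (GenVerma Φ k) :=
    { p with
      smul_mem' := fun u w hw => smul_mem_of_stable p (fun x i w hw => hpA i x w hw)
        (fun w hw => by rw [uTildeC_smul_verma]; exact p.smul_mem _ hw) hpD u w hw }
  -- A submodule missing the vacuum is proper, hence is one of the summands of the maximal
  -- submodule.
  have hq : q ≤ maxSubmodule Φ k :=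
    le_sSup fun h => hpv (show vermaVacuum Φ k ∈ q from h ▸ Submodule.mem_top)
  refine hq ?_
  rw [← powVec_tildeLevelAction Φ (uTildeC_smul_verma Φ k)]
  exact hpR m

/-- The action of `𝒰` on a `g̃`-module on which `c` acts by `k`. -/
def envActionOn {M : Type*} [AddCommGroup M] [Module (UniversalEnvelopingAlgebra ℂ (Tilde Φ)) M]
    [Module ℂ M] [IsScalarTower ℂ (UniversalEnvelopingAlgebra ℂ (Tilde Φ)) M]
    (hc : ∀ w : M, uTildeC Φ • w = (k : ℂ) • w) : EnvLevel Φ k →ₐ[ℂ] Module.End ℂ M :=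
  RingQuot.liftAlgHom ℂ ⟨(Algebra.lsmul ℂ ℂ M).comp (UniversalEnvelopingAlgebra.lift ℂ
    ((UniversalEnvelopingAlgebra.ι ℂ).comp (hatToTilde Φ))), by
    rintro _ _ ⟨⟩
    rw [AlgHom.comp_apply, UniversalEnvelopingAlgebra.lift_ι_apply, AlgHom.commutes]
    ext w
    exact hc w⟩

theorem envActionOn_envElt {M : Type*} [AddCommGroup M]
    [Module (UniversalEnvelopingAlgebra ℂ (Tilde Φ)) M]
    [Module ℂ M] [IsScalarTower ℂ (UniversalEnvelopingAlgebra ℂ (Tilde Φ)) M]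
    (hc : ∀ w : M, uTildeC Φ • w = (k : ℂ) • w) (x : g) (i : ℤ) (w : M) :
    envActionOn Φ k hc (envElt Φ k x i) w = uTildeElt Φ x i • w := by
  have h : envElt Φ k x i =
    RingQuot.mkAlgHom ℂ (LevelRel Φ k) (UniversalEnvelopingAlgebra.ι ℂ (hatElt Φ x i)) := rfl
  rw [h, envActionOn, RingQuot.liftAlgHom_mkAlgHom_apply, AlgHom.comp_apply,
    UniversalEnvelopingAlgebra.lift_ι_apply]
  rfl

/-- The action of `𝒰` on the standard module. -/
def envAction : EnvLevel Φ k →ₐ[ℂ] Module.End ℂ (StdModule Φ k) :=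
  envActionOn Φ k (uTildeC_smul_std Φ k)

theorem envAction_envElt (x : g) (i : ℤ) (w : StdModule Φ k) :
    envAction Φ k (envElt Φ k x i) w = uTildeElt Φ x i • w :=
  envActionOn_envElt Φ k _ x i w

theorem envAction_prod (l : List (g × ℤ)) (w : StdModule Φ k) :
    envAction Φ k (l.map fun p => envElt Φ k p.1 p.2).prod w =
      (l.map fun p => uTildeElt Φ p.1 p.2).prod • w := by
  induction l with
  | nil => rw [List.map_nil, List.prod_nil, map_one, List.map_nil, List.prod_nil, one_smul]; rfl
  | cons a l ih =>
    rw [List.map_cons, List.prod_cons, map_mul, Module.End.mul_apply, ih, envAction_envElt,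
      List.map_cons, List.prod_cons, mul_smul]

theorem envAction_tailIdeal {a : EnvLevel Φ k} (ha : a ∈ tailIdeal Φ k 0) :
    envAction Φ k a (vacuum Φ k) = 0 := by
  induction ha using Submodule.span_induction with
  | mem a ha =>
    obtain ⟨x, j, hj, rfl⟩ := ha
    rw [envAction_envElt, uTildeElt_smul_vacuum Φ k x (by simpa using hj)]
  | zero => simp
  | add a b _ _ ha hb => rw [map_add, LinearMap.add_apply, ha, hb, add_zero]
  | smul r a _ ha => rw [smul_eq_mul, map_mul, Module.End.mul_apply, ha, map_zero]

theorem algHom_commutator_apply_eq_zero {A V : Type*} [Ring A] [Algebra ℂ A] [AddCommGroup V]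
    [Module ℂ V] (F : A →ₐ[ℂ] Module.End ℂ V) {a b : A} {v : V} (ha : F a v = 0) (hb : F b v = 0) :
    F (a * b - b * a) v = 0 := by
  rw [map_sub, map_mul, map_mul, LinearMap.sub_apply, Module.End.mul_apply, Module.End.mul_apply,
    ha, hb, map_zero, map_zero, sub_zero]

/-- For a generator, both terms of x(0)a - a x(0) kill the vacuum, because a and x(0) do. -/
theorem envAction_adAction (u : UniversalEnvelopingAlgebra ℂ g) :
    ∀ a : EnvLevel Φ k, envAction Φ k a (vacuum Φ k) = 0 →
      envAction Φ k (adAction Φ k u a) (vacuum Φ k) = 0 := by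
  induction u using UniversalEnvelopingAlgebra.induction with
  | algebraMap r =>
    intro a ha
    rw [AlgHom.commutes, Module.algebraMap_end_apply, map_smul, LinearMap.smul_apply, ha, smul_zero]
  | mul u v hu hv =>
    intro a ha
    rw [map_mul, Module.End.mul_apply]
    exact hu _ (hv a ha)
  | add u v hu hv =>
    intro a ha
    rw [map_add (adAction Φ k), LinearMap.add_apply, map_add (envAction Φ k), LinearMap.add_apply,
      hu a ha, hv a ha, add_zero]
  | ι x =>
    intro a ha
    refine (congrArg (envAction Φ k · (vacuum Φ k)) (adAction_ι Φ k x a)).trans ?_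
    exact algHom_commutator_apply_eq_zero (envAction Φ k)
      ((envAction_envElt Φ k x 0 _).trans (uTildeElt_smul_vacuum Φ k x le_rfl)) ha

theorem envAction_relTrunc {x : g} (hx0 : x ≠ 0)
    (hx : ∀ y, ⁅x, ⁅x, y⁆⁆ = (-2 * Φ.form y x) • x) (u : UniversalEnvelopingAlgebra ℂ g) (m : ℤ) :
    envAction Φ k (relTrunc Φ k x u m 0) (vacuum Φ k) = 0 := by
  rw [relTrunc, ← map_sum]
  refine envAction_adAction Φ k u _ ?_
  rw [map_sum, LinearMap.sum_apply, ← uTildePow_smul_vacuum Φ k hx0 hx m, uTildePow,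
    Finset.sum_smul]
  refine Finset.sum_congr rfl fun j _ => ?_
  have h1 : (List.ofFn fun i => envElt Φ k x (j i)) =
      (List.ofFn fun i => (x, j i)).map fun p => envElt Φ k p.1 p.2 := by
    rw [List.map_ofFn]; rfl
  have h2 : (List.ofFn fun i => uTildeElt Φ x (j i)) =
      (List.ofFn fun i => (x, j i)).map fun p => uTildeElt Φ p.1 p.2 := by
    rw [List.map_ofFn]; rfl
  rw [h1, h2, envAction_prod]

variable {Φ k} {ι : Type*} (B : Module.Basis ι ℂ g) (o : PartOrder ι)

theorem envAction_envMonomial (P : ColPart ι) :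
    envAction Φ k (envMonomial Φ k B o P) (vacuum Φ k) = monomialVector Φ k B o P := by
  have h (A : Type _) (X : g → ℤ → A) (l : List (ι × ℤ)) : (l.map fun p => X (B p.1) p.2) =
      (l.map fun p => (B p.1, p.2)).map fun p => X p.1 p.2 := by
    rw [List.map_map]; rfl
  rw [envMonomial, monomialVector, PartOrder.monomial, PartOrder.monomial,
    h _ (envElt Φ k), h _ (uTildeElt Φ), envAction_prod]

/-- An expansion of a relation gives a linear relation between monomial vectors. -/
theorem IsExpansion.sum_monomialVector {x : g} (hx0 : x ≠ 0)
    (hx : ∀ y, ⁅x, ⁅x, y⁆⁆ = (-2 * Φ.form y x) • x) {u : UniversalEnvelopingAlgebra ℂ g} {m : ℤ}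
    {c : ColPart ι → ℂ} (h : IsExpansion Φ k x B o u m c) :
    ∃ s : Finset (ColPart ι), (∀ Ψ, Ψ ∈ s ↔ Ψ ∈ negParts ι ∧ c Ψ ≠ 0) ∧
      ∑ Ψ ∈ s, c Ψ • monomialVector Φ k B o Ψ = 0 := by
  -- The cutoff N = 0 suffices: `tailIdeal Φ k 0` kills the vacuum, and only partitions with
  -- negative parts remain.
  obtain ⟨s, hs, h⟩ := h 0
  refine ⟨s, by simpa [negParts] using hs, ?_⟩
  have h1 := envAction_tailIdeal Φ k h
  rw [map_sub, LinearMap.sub_apply, envAction_relTrunc Φ k hx0 hx, zero_sub, neg_eq_zero, map_sum,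
    LinearMap.sum_apply] at h1
  rw [← h1]
  refine Finset.sum_congr rfl fun Ψ _ => ?_
  rw [map_smul, LinearMap.smul_apply, envAction_envMonomial]

end Vacuum

/-! ### Reordering monomials and reduction by leading terms -/

section Words

namespace LevelAction

variable {Φ : InvForm g} {k : ℂ} {V : Type*} [AddCommGroup V] [Module ℂ V]
  (A : LevelAction Φ k V) {ι : Type*} (B : Module.Basis ι ℂ g) (v : V)

/-- The operator `X₁(j₁) ⋯ X_ℓ(j_ℓ)` of a list of parts. -/
def wordOp (l : List (ι × ℤ)) : Module.End ℂ V := (l.map fun p => A.op p.2 (B p.1)).prod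

/-- The span of the vectors `X₁(j₁) ⋯ X_ℓ(j_ℓ) v` with `ℓ < n`. -/
def shortSpan (n : ℕ) : Submodule ℂ V :=
  Submodule.span ℂ {w | ∃ l : List (ι × ℤ), l.length < n ∧ w = A.wordOp B l v}

theorem wordOp_cons (p : ι × ℤ) (l : List (ι × ℤ)) (w : V) :
    A.wordOp B (p :: l) w = A.op p.2 (B p.1) (A.wordOp B l w) := by
  rw [wordOp, List.map_cons, List.prod_cons]; rfl

theorem wordOp_append (l l' : List (ι × ℤ)) (w : V) :
    A.wordOp B (l ++ l') w = A.wordOp B l (A.wordOp B l' w) := by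
  rw [wordOp, List.map_append, List.prod_append]; rfl

theorem wordOp_mem_shortSpan {l : List (ι × ℤ)} {n : ℕ} (h : l.length < n) :
    A.wordOp B l v ∈ A.shortSpan B v n := Submodule.subset_span ⟨l, h, rfl⟩

theorem shortSpan_mono {m n : ℕ} (h : m ≤ n) : A.shortSpan B v m ≤ A.shortSpan B v n :=
  Submodule.span_mono fun _ ⟨l, hl, hw⟩ => ⟨l, hl.trans_le h, hw⟩

theorem op_mem_shortSpan (i : ℤ) (x : g) {n : ℕ} {w : V} (hw : w ∈ A.shortSpan B v n) :
    A.op i x w ∈ A.shortSpan B v (n + 1) := by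
  induction B.mem_span x using Submodule.span_induction with
  | mem x hx =>
    obtain ⟨b, rfl⟩ := hx
    induction hw using Submodule.span_induction with
    | mem w hw =>
      obtain ⟨l, hl, rfl⟩ := hw
      rw [← A.wordOp_cons B (b, i)]
      exact A.wordOp_mem_shortSpan B v (by simpa using hl)
    | zero => rw [map_zero]; exact zero_mem _
    | add a b _ _ ha hb => rw [map_add]; exact add_mem ha hb
    | smul r a _ ha => rw [map_smul]; exact Submodule.smul_mem _ r ha
  | zero => rw [map_zero]; exact zero_mem _
  | add a b _ _ ha hb => rw [map_add]; exact add_mem ha hb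
  | smul r a _ ha => rw [map_smul]; exact Submodule.smul_mem _ r ha

/-- Permuting the factors changes a word by shorter words. -/
theorem wordOp_sub_mem_of_perm {l l' : List (ι × ℤ)} (h : l.Perm l') :
    A.wordOp B l v - A.wordOp B l' v ∈ A.shortSpan B v l.length := by
  induction h with
  | nil => rw [sub_self]; exact zero_mem _
  | cons p h ih =>
    rw [A.wordOp_cons, A.wordOp_cons, ← map_sub]
    exact A.op_mem_shortSpan B v _ _ ih
  | swap p q l =>
    have hl := A.wordOp_mem_shortSpan B v (Nat.lt_succ_self l.length)
    rw [A.wordOp_cons, A.wordOp_cons, A.wordOp_cons, A.wordOp_cons, A.comm, add_assoc,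
      add_sub_cancel_left]
    exact add_mem (A.op_mem_shortSpan B v _ _ hl)
      (Submodule.smul_mem _ _ (A.shortSpan_mono B v (Nat.le_succ _) hl))
  | trans h _ ih ih' =>
    rw [← sub_add_sub_cancel]
    exact add_mem ih (h.length_eq ▸ ih')

variable (o : PartOrder ι)

open Classical in
/-- The vector `X(P) v`. -/
def monVec (P : ColPart ι) : V := A.wordOp B (P.sort o.partLE) v

/-- The span of the vectors `X(P) v` with `P` of length less than `n`. -/
def monSpan (n : ℕ) : Submodule ℂ V :=
  Submodule.span ℂ {w | ∃ P : ColPart ι, P.card < n ∧ w = A.monVec B v o P}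

theorem monSpan_mono {m n : ℕ} (h : m ≤ n) : A.monSpan B v o m ≤ A.monSpan B v o n :=
  Submodule.span_mono fun _ ⟨l, hl, hw⟩ => ⟨l, hl.trans_le h, hw⟩

theorem wordOp_sub_monVec_mem_shortSpan (l : List (ι × ℤ)) :
    A.wordOp B l v - A.monVec B v o (l : ColPart ι) ∈ A.shortSpan B v l.length := by
  classical
  exact A.wordOp_sub_mem_of_perm B v
    (Multiset.coe_eq_coe.1 (Multiset.sort_eq (l : ColPart ι) o.partLE).symm)

/-- Sorting a word costs only shorter words, which are sorted by induction on length. -/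
theorem shortSpan_le_monSpan (n : ℕ) : A.shortSpan B v n ≤ A.monSpan B v o n := by
  induction n using Nat.strong_induction_on with
  | _ n ih =>
    refine Submodule.span_le.2 ?_
    rintro _ ⟨l, hl, rfl⟩
    rw [← sub_add_cancel (A.wordOp B l v) (A.monVec B v o (l : ColPart ι))]
    exact add_mem (A.monSpan_mono B v o hl.le (ih _ hl (A.wordOp_sub_monVec_mem_shortSpan B v o l)))
      (Submodule.subset_span ⟨(l : ColPart ι), by simpa using hl, rfl⟩)

theorem wordOp_sub_monVec_mem (l : List (ι × ℤ)) :
    A.wordOp B l v - A.monVec B v o (l : ColPart ι) ∈ A.monSpan B v o l.length :=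
  A.shortSpan_le_monSpan B v o _ (A.wordOp_sub_monVec_mem_shortSpan B v o l)

theorem _root_.AffineStd.PartOrder.snd_le_of_partLE {o : PartOrder ι} {p q : ι × ℤ}
    (h : o.partLE p q) : p.2 ≤ q.2 := by
  by_contra! hlt
  have h1 : o.le {q} {p} := o.le_of_degree _ _ (by simp) (by simpa [ColPart.degree] using hlt)
  have h2 := Multiset.singleton_inj.1 (o.antisymm _ _ h h1)
  rw [h2] at hlt
  exact hlt.false

variable {v}

/-- The words are eigenvectors of every operator `D` with `[D, x(i)] = i x(i)` and `D v = 0`. -/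
theorem apply_wordOp_eq_smul (D : Module.End ℂ V)
    (hD : ∀ i y w, D (A.op i y w) = A.op i y (D w) + (i : ℂ) • A.op i y w) (hDv : D v = 0)
    (l : List (ι × ℤ)) : ∃ d : ℂ, D (A.wordOp B l v) = d • A.wordOp B l v := by
  induction l with
  | nil => exact ⟨0, by rw [zero_smul]; exact hDv⟩
  | cons p l ih =>
    obtain ⟨d, hd⟩ := ih
    exact ⟨d + p.2, by rw [A.wordOp_cons, hD, hd, map_smul, ← add_smul]⟩

variable (hv : ∀ (y : g) (i : ℤ), 0 ≤ i → A.op i y v = 0)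
include hv

/-- In a sorted word the degrees increase weakly to the right, so a nonnegative part forces the
rightmost factor, which acts first, to kill `v`. -/
theorem wordOp_eq_zero {l : List (ι × ℤ)} (hl : l.Pairwise o.partLE) (h : ∃ p ∈ l, 0 ≤ p.2) :
    A.wordOp B l v = 0 := by
  induction l with
  | nil => simp at h
  | cons p l ih =>
    rw [List.pairwise_cons] at hl
    rw [A.wordOp_cons]
    by_cases h' : ∃ q ∈ l, 0 ≤ q.2
    · rw [ih hl.2 h', map_zero]
    · obtain ⟨q, hq, hq0⟩ := h
      rcases List.mem_cons.1 hq with rfl | hq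
      · have hnil : l = [] := List.eq_nil_iff_forall_not_mem.2 fun r hr =>
          h' ⟨r, hr, hq0.trans (PartOrder.snd_le_of_partLE (hl.1 r hr))⟩
        rw [hnil]
        exact hv _ _ hq0
      · exact absurd ⟨q, hq, hq0⟩ h'

theorem monVec_eq_zero {P : ColPart ι} (hP : P ∉ negParts ι) : A.monVec B v o P = 0 := by
  classical
  simp only [negParts, Set.mem_ofPred_eq, not_forall, not_lt] at hP
  obtain ⟨p, hp, hp0⟩ := hP
  exact A.wordOp_eq_zero B o hv (Multiset.pairwise_sort _ _) ⟨p, (Multiset.mem_sort _).2 hp, hp0⟩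

/-- If every `Λ ∈ R` with negative parts is the smallest partition in a linear relation between the
monomial vectors, then these are spanned by those of the partitions that contain no `Λ ∈ R`. -/
theorem monVec_mem_span (R : Set (ColPart ι))
    (hR : ∀ Λ ∈ R, Λ ∈ negParts ι → ∃ (s : Finset (ColPart ι)) (c : ColPart ι → ℂ),
      Λ ∈ s ∧ c Λ ≠ 0 ∧ (∀ Ψ ∈ s, o.le Λ Ψ) ∧ ∑ Ψ ∈ s, c Ψ • A.monVec B v o Ψ = 0)
    (P : ColPart ι) :
    A.monVec B v o P ∈ Submodule.span ℂ
      {w | ∃ P ∈ {P | ∀ Λ ∈ R, ¬ Λ ≤ P} ∩ negParts ι, w = A.monVec B v o P} := by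
  classical
  set T := Submodule.span ℂ
      {w | ∃ P ∈ {P | ∀ Λ ∈ R, ¬ Λ ≤ P} ∩ negParts ι, w = A.monVec B v o P} with hT
  by_contra hbad
  -- A largest counterexample exists among partitions with negative parts; those with a nonnegative
  -- part give the zero vector.
  obtain ⟨P, ⟨hPneg, hP⟩, hmax⟩ := o.exists_max {P | P ∈ negParts ι ∧ A.monVec B v o P ∉ T}
    ⟨P, by by_contra h; exact hbad (by rw [A.monVec_eq_zero B o hv h]; exact zero_mem _), hbad⟩
    fun _ h => h.1
  have hgt : ∀ Q, o.le P Q → P ≠ Q → A.monVec B v o Q ∈ T := by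
    intro Q hPQ hne
    by_contra hQ
    by_cases hn : Q ∈ negParts ι
    · exact hne (o.antisymm _ _ hPQ (hmax Q ⟨hn, hQ⟩))
    · exact hQ (by rw [A.monVec_eq_zero B o hv hn]; exact zero_mem _)
  have hshort : A.monSpan B v o P.card ≤ T := by
    refine Submodule.span_le.2 ?_
    rintro _ ⟨Q, hQ, rfl⟩
    exact hgt Q (o.le_of_length _ _ hQ) (by rintro rfl; exact hQ.false)
  by_cases hPD : ∀ Λ ∈ R, ¬ Λ ≤ P
  · exact hP (Submodule.subset_span ⟨P, ⟨hPD, hPneg⟩, rfl⟩)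
  push Not at hPD
  obtain ⟨Λ, hΛ, hle⟩ := hPD
  obtain ⟨Ψ, hΨ⟩ := Multiset.le_iff_exists_add.1 hle
  rw [add_comm] at hΨ
  obtain ⟨s, c, hs, hc, hmin, hsum⟩ := hR Λ hΛ fun p hp => hPneg p (Multiset.mem_of_le hle hp)
  let F := A.wordOp B (Ψ.sort o.partLE)
  -- Merging X(Ψ)X(Q) into X(ΨQ) leaves an error of length below that of ΨQ, hence below that of P;
  -- shorter partitions are larger than P and already treated.
  have hF : ∀ Q, Q.card ≤ Λ.card → F (A.monVec B v o Q) - A.monVec B v o (Ψ + Q) ∈ T := by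
    intro Q hQ
    have h := A.wordOp_sub_monVec_mem B v o (Ψ.sort o.partLE ++ Q.sort o.partLE)
    rw [A.wordOp_append, ← Multiset.coe_add, Multiset.sort_eq, Multiset.sort_eq,
      List.length_append, Multiset.length_sort, Multiset.length_sort] at h
    exact hshort (A.monSpan_mono B v o (by rw [hΨ, Multiset.card_add]; lia) h)
  -- A longer Q would precede Λ, against minimality.
  have hcard : ∀ Q ∈ s, Q.card ≤ Λ.card := by
    intro Q hQ
    by_contra! hlt
    have := o.antisymm _ _ (hmin Q hQ) (o.le_of_length _ _ hlt)
    rw [this] at hlt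
    exact hlt.false
  have hrest : ∀ Q ∈ s.erase Λ, c Q • F (A.monVec B v o Q) ∈ T := by
    intro Q hQ
    have hQs := Finset.mem_of_mem_erase hQ
    refine T.smul_mem _ ?_
    rw [← sub_add_cancel (F _) (A.monVec B v o (Ψ + Q))]
    refine add_mem (hF Q (hcard Q hQs)) (hgt _ ?_ ?_)
    · rw [hΨ]; exact o.mul_le_mul _ _ _ (hmin Q hQs)
    · rw [hΨ]; exact fun h => Finset.ne_of_mem_erase hQ (add_left_cancel h).symm
  have hΛT : c Λ • F (A.monVec B v o Λ) ∈ T := by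
    have h := congrArg F hsum
    rw [map_zero, map_sum, ← Finset.add_sum_erase _ _ hs, map_smul] at h
    rw [eq_neg_of_add_eq_zero_left h]
    exact neg_mem (sum_mem fun Q hQ => by rw [map_smul]; exact hrest Q hQ)
  rw [T.smul_mem_iff hc] at hΛT
  refine hP ?_
  rw [hΨ, ← sub_sub_cancel (F (A.monVec B v o Λ)) (A.monVec B v o (Ψ + Λ))]
  exact sub_mem hΛT (hF Λ le_rfl)

end LevelAction
end Words

/-! ### Spanning of the standard module by all monomial vectors -/

section Main

variable {Φ : InvForm g} {k : ℕ} {ι : Type*} (B : Module.Basis ι ℂ g) (o : PartOrder ι)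

theorem wordOp_std (l : List (ι × ℤ)) :
    (tildeLevelAction (uTildeC_smul_std Φ k)).wordOp B l (vacuum Φ k) =
      (l.map fun p => uTildeElt Φ (B p.1) p.2).prod • vacuum Φ k := by
  induction l with
  | nil => rw [List.map_nil, List.prod_nil, one_smul]; rfl
  | cons p l ih =>
    rw [LevelAction.wordOp_cons, ih, List.map_cons, List.prod_cons, mul_smul, tildeLevelAction_op]

theorem monVec_std (P : ColPart ι) :
    (tildeLevelAction (uTildeC_smul_std Φ k)).monVec B (vacuum Φ k) o P =
      monomialVector Φ k B o P :=
  wordOp_std B _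

/-- The standard module is spanned by the vectors `X(P) 1`. -/
theorem span_monVec_std : Submodule.span ℂ (Set.range fun P =>
    (tildeLevelAction (uTildeC_smul_std Φ k)).monVec B (vacuum Φ k) o P) = ⊤ := by
  set A := tildeLevelAction (uTildeC_smul_std Φ k) with hA
  -- The span of all words applied to the vacuum is stable under every x(i), under c (a scalar) and
  -- under d (words are eigenvectors); it contains the vacuum, the empty word, so it is everything.
  let W : Submodule ℂ (StdModule Φ k) := ⨆ n, A.shortSpan B (vacuum Φ k) n
  have hdir : Directed (· ≤ ·) (A.shortSpan B (vacuum Φ k)) :=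
    (monotone_nat_of_le_succ fun n => A.shortSpan_mono B _ n.le_succ).directed_le
  have hW : ∀ w, w ∈ W ↔ ∃ n, w ∈ A.shortSpan B (vacuum Φ k) n := fun w =>
    Submodule.mem_iSup_of_directed _ hdir
  have hWtop : ∀ w, w ∈ W := by
    intro w
    obtain ⟨u, rfl⟩ := exists_smul_vacuum Φ k w
    refine smul_mem_of_stable W ?_ ?_ ?_ u _ ?_
    · intro x i w hw
      obtain ⟨n, hn⟩ := (hW w).1 hw
      exact (hW _).2 ⟨n + 1, A.op_mem_shortSpan B _ i x hn⟩
    · intro w hw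
      rw [uTildeC_smul_std]
      exact W.smul_mem _ hw
    · intro w hw
      obtain ⟨n, hn⟩ := (hW w).1 hw
      refine (hW _).2 ⟨n, ?_⟩
      clear hw
      change Algebra.lsmul ℂ ℂ _ (uTildeD Φ) w ∈ _
      induction hn using Submodule.span_induction with
      | mem w hw =>
        obtain ⟨l, hl, rfl⟩ := hw
        obtain ⟨d, hd⟩ := A.apply_wordOp_eq_smul B (v := vacuum Φ k)
          (Algebra.lsmul ℂ ℂ _ (uTildeD Φ)) (fun i y w => by
            simp only [Algebra.lsmul_coe, hA, tildeLevelAction_op]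
            rw [← mul_smul, uTildeD_mul, add_smul, mul_smul, smul_assoc])
          (uTildeD_smul_vacuum Φ k) l
        rw [hd]
        exact Submodule.smul_mem _ _ (A.wordOp_mem_shortSpan B _ hl)
      | zero => rw [map_zero]; exact zero_mem _
      | add a b _ _ ha hb => rw [map_add]; exact add_mem ha hb
      | smul r a _ ha => rw [map_smul]; exact Submodule.smul_mem _ r ha
    · exact (hW _).2 ⟨1, A.wordOp_mem_shortSpan B _ (l := []) one_pos⟩
  refine eq_top_iff.2 fun w _ => ?_
  obtain ⟨n, hn⟩ := (hW w).1 (hWtop w)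
  refine Submodule.span_mono ?_ (A.shortSpan_le_monSpan B _ o n hn)
  intro _ ⟨P, _, hP⟩
  exact ⟨P, hP.symm⟩

end Main
end
end AffineStd

theorem propositionP {g : Type*} [LieRing g] [LieAlgebra ℂ g] [FiniteDimensional ℂ g]
    [LieAlgebra.IsSimple ℂ g] (H : LieSubalgebra ℂ g) [H.IsCartanSubalgebra]
    (b : (LieAlgebra.IsKilling.rootSystem H).Base) (θ : H.root)
    (hθ : AffineStd.IsMaximalRoot b θ)
    (Φ : AffineStd.InvForm g) (hΦ : AffineStd.IsNormalized Φ θ)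
    (xθ : g) (hxθ : xθ ∈ LieAlgebra.rootSpace H (θ : LieModule.Weight ℂ H g)) (hxθ0 : xθ ≠ 0)
    (k : ℕ) (hk : 0 < k)
    {ι : Type*} (B : Module.Basis ι ℂ g) (o : AffineStd.PartOrder ι) :
    Submodule.span ℂ
      {v | ∃ P ∈ AffineStd.differenceSet Φ k xθ B o ∩ AffineStd.negParts ι,
        v = AffineStd.monomialVector Φ k B o P} = ⊤ := by
  have hx := AffineStd.lie_lie_of_isMaximalRoot b θ hθ Φ hΦ xθ hxθ
  rw [eq_top_iff, ← AffineStd.span_monVec_std B o, Submodule.span_le]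
  rintro _ ⟨P, rfl⟩
  have h := (AffineStd.tildeLevelAction (AffineStd.uTildeC_smul_std Φ k)).monVec_mem_span B o
    (v := AffineStd.vacuum Φ k) (fun y i hi => AffineStd.uTildeElt_smul_vacuum Φ k y hi)
    (AffineStd.leadingTerms Φ k xθ B o) (fun Λ hΛ hΛn => by
      obtain ⟨u, m, c, hexp, hcΛ, hmin⟩ := hΛ
      obtain ⟨s, hs, hsum⟩ := hexp.sum_monomialVector B o hxθ0 hx
      refine ⟨s, c, (hs Λ).2 ⟨hΛn, hcΛ⟩, hcΛ, fun Ψ hΨ => hmin Ψ ((hs Ψ).1 hΨ).2, ?_⟩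
      simpa only [AffineStd.monVec_std] using hsum) P
  simp only [AffineStd.monVec_std] at h ⊢
  exact h
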